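/- **Setting.** Let $p$ be a probability density (law) on $\mathcal X$, $d\ge 2$, and let $r(x;\theta)=\exp\{\alpha+\phi(x;\beta)\}$, $\theta=(\alpha,\beta)\in\mathbb R\times\mathbb R^{d-1}$, where $\phi$ is measurable in $x$ and differentiable in $\beta$; let $r(x;\theta^*)=1$ for all $x$, with $\theta^*=(\alpha^*,\beta^*)$. Let $f$ be convex on $(0,\infty)$, twice continuously differentiable near $1$, with $f(1)=f'(1)=0$ and $f''(1)>0$. The sample sizes $m_{\rm n},m_{\rm d}$ tend to infinity with $m_{\rm n}/m_{\rm d}\to\rho\in(0,\infty)$, and $m=m_{\rm n}m_{\rm d}/(m_{\rm n}+m_{\rm d})$. Let $\theta_m=\theta^*+h_m/\sqrt m$ with $h_m\to h\in\mathbb R^d$, $p_{\rm d}=p$, and let $$p_{\rm n}^{(m)}(x)=p_{\rm d}(x)\Big(r(x;\theta_m)+\frac{s_m(x)+\varepsilon_m}{\sqrt m}\Big)$$ be probability densities, where $\int s_m\,p\,dx=0$, $\varepsilon_m\to\varepsilon\in\mathbb R$, and $s_m/\sqrt m\to0$ in $p$-probability (the density ratio $p_{\rm n}^{(m)}/p_{\rm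 d}$ need not belong to the model). The data are independent i.i.d. samples $x^{({\rm n})}_1,\dots,x^{({\rm n})}_{m_{\rm n}}$ from $p_{\rm n}^{(m)}$ and $x^{({\rm d})}_1,\dots,x^{({\rm d})}_{m_{\rm d}}$ from $p_{\rm d}$; all probabilities and limits in probability or in law below refer to this sampling. **Assumptions.** 1. The matrices $M(\theta)=\int p\,\nabla\log r\,\nabla\log r^T dx$ and $U(\theta)=\int p\,(1+\rho r)^{-1}\nabla\log r\,\nabla\log r^T dx$ are finite, continuous and non-degenerate in a neighbourhood of $\theta^*$. 2. $\frac1{m_{\rm n}}\sum_j\nabla r(x^{({\rm n})}_j;\theta^*)\nabla r(x^{({\rm n})}_j;\theta^*)^T\to M(\theta^*)$ in probability. 3. (Domination) There are $\delta>0$ and a measurable $p$-integrable $G$ such that, for $p$-almost every $x$, $f(r(x;\theta))/(1+\rho r(x;\theta))\le G(x)\|\theta-\theta^*\|^2$ whenever $\|\theta-\theta^*\|<\delta$, and $\frac1{m_{\rm n}}\sum_jG(x^{({\rm n})}_j)\to\int G\,p\,dx$ in probability. 4. $\widehat\theta$ is a measurable function of the data that solves, exactly or up to an error tending to $0$ in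 probability, the moment matching equation $$\frac1{m_{\rm d}}\sum_i r(x^{({\rm d})}_i;\theta)\eta(x^{({\rm d})}_i;\theta)-\frac1{m_{\rm n}}\sum_j\eta(x^{({\rm n})}_j;\theta)=0,\qquad \eta(x;\theta)=\frac{\nabla\log r(x;\theta)}{1+\rho_m r(x;\theta)},\quad \rho_m=\frac{m_{\rm n}}{m_{\rm d}},$$ and $$\sqrt m\,U(\theta_m)(\widehat\theta-\theta_m)\ \to\ N\Big(0,\tfrac1{(1+\rho)^2}V[\nabla r]\Big)\quad\text{in law},$$ where $V[\nabla r]$ is the covariance matrix of $\nabla r(x;\theta^*)$ under $p$. 5. $\widehat V$ is a measurable matrix-valued function of the data that converges in probability to the covariance matrix of $\nabla_\beta\phi(x;\beta^*)$ under $p$. **Tests.** Let $0<a<1$ and let $\chi^2_{d-1}(1-a)$ be the $(1-a)$-quantile of the chi-square distribution with $d-1$ degrees of freedom. The $\widehat D_f$-based test rejects $p_{\rm n}=p_{\rm d}$ when $\widehat D_f\ge\frac{f''(1)}{2m}\chi^2_{d-1}(1-a)$, where $$\widehat D_f=\frac1{m_{\rm d}}\sum_i\frac{f(r(x^{({\rm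 d})}_i;\widehat\theta))}{1+\rho_m r(x^{({\rm d})}_i;\widehat\theta)}+\frac1{m_{\rm n}}\sum_j\frac{\rho_m f(r(x^{({\rm n})}_j;\widehat\theta))}{1+\rho_m r(x^{({\rm n})}_j;\widehat\theta)}.$$ The empirical likelihood test rejects when $S=m(\widehat\beta-\beta^*)^T\widehat V(\widehat\beta-\beta^*)>\chi^2_{d-1}(1-a)$. **Conclusion.** The rejection probabilities of both tests under these local alternatives converge, and the limit (asymptotic power) for the $\widehat D_f$-based test is greater than or equal to the limit for the empirical likelihood test. -/

import Mathlib

open MeasureTheory ProbabilityTheory Filter Topology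

noncomputable section

namespace DensityRatio

/-- Euclidean space `ℝⁿ`. A parameter `θ = (α, β) ∈ ℝ × ℝ^q` is a vector of `Vec (q + 1)` whose
coordinate `0` is `α` and whose remaining coordinates form `β`; thus `d = q + 1`. -/
abbrev Vec (n : ℕ) : Type := EuclideanSpace ℝ (Fin n)

/-- The `β`-part of `θ = (α, β)`. -/
def betaPart {q : ℕ} (θ : Vec (q + 1)) : Vec q := WithLp.toLp 2 fun i => θ i.succ

section Model

variable {X : Type*} {q : ℕ}

/-- The density ratio model `r(x; θ) = exp (α + φ(x; β))`. -/
def ratio (φ : X → Vec q → ℝ) (x : X) (θ : Vec (q + 1)) : ℝ :=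
  Real.exp (θ 0 + φ x (betaPart θ))

/-- `∇ r(x; θ)`, the gradient with respect to `θ`. -/
def gradRatio (φ : X → Vec q → ℝ) (x : X) (θ : Vec (q + 1)) : Vec (q + 1) :=
  gradient (fun θ' => ratio φ x θ') θ

/-- `∇ log r(x; θ)`, the gradient with respect to `θ`. -/
def gradLogRatio (φ : X → Vec q → ℝ) (x : X) (θ : Vec (q + 1)) : Vec (q + 1) :=
  gradient (fun θ' => Real.log (ratio φ x θ')) θ

/-- `η_opt(x; θ) = ∇ log r(x; θ) / (1 + ρ r(x; θ))`. -/
def etaOpt (φ : X → Vec q → ℝ) (ρ : ℝ) (x : X) (θ : Vec (q + 1)) : Vec (q + 1) :=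
  (1 + ρ * ratio φ x θ)⁻¹ • gradLogRatio φ x θ

/-- The function `f_d(t) = f(t) / (1 + ρ t)` of the decomposition `f(t) = f_d(t) + t f_n(t)`. -/
def fD (f : ℝ → ℝ) (ρ t : ℝ) : ℝ := f t / (1 + ρ * t)

/-- The function `f_n(t) = ρ f(t) / (1 + ρ t)` of the decomposition `f(t) = f_d(t) + t f_n(t)`. -/
def fN (f : ℝ → ℝ) (ρ t : ℝ) : ℝ := ρ * f t / (1 + ρ * t)

end Model

section Population

variable {X : Type*} [MeasurableSpace X] {q : ℕ}

/-- `M(θ) = ∫ p ∇ log r (∇ log r)ᵀ`. -/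
def matM (P : Measure X) (φ : X → Vec q → ℝ) (θ : Vec (q + 1)) :
    Matrix (Fin (q + 1)) (Fin (q + 1)) ℝ :=
  Matrix.of fun i j => ∫ x, gradLogRatio φ x θ i * gradLogRatio φ x θ j ∂P

/-- `U(θ) = ∫ p (1 + ρ r)⁻¹ ∇ log r (∇ log r)ᵀ`. -/
def matU (P : Measure X) (φ : X → Vec q → ℝ) (ρ : ℝ) (θ : Vec (q + 1)) :
    Matrix (Fin (q + 1)) (Fin (q + 1)) ℝ :=
  Matrix.of fun i j =>
    ∫ x, (1 + ρ * ratio φ x θ)⁻¹ * (gradLogRatio φ x θ i * gradLogRatio φ x θ j) ∂P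

/-- The variance-covariance matrix of a random vector under `P`. -/
def covMat {n : ℕ} (P : Measure X) (g : X → Vec n) : Matrix (Fin n) (Fin n) ℝ :=
  Matrix.of fun i j => cov[fun x => g x i, fun x => g x j; P]

/-- The law with density `r(x; θ) + (s(x) + e) / √m` with respect to `P`. -/
def altLaw (P : Measure X) (φ : X → Vec q → ℝ) (θ : Vec (q + 1)) (s : X → ℝ) (e m : ℝ) :
    Measure X :=
  P.withDensity fun x => ENNReal.ofReal (ratio φ x θ + (s x + e) / √m)

end Population

/-- The harmonic sample size `m = mₙ m_d / (mₙ + m_d)`. -/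
def effSize (mn md : ℕ) : ℝ := (mn * md : ℝ) / (mn + md)

/-- The sample ratio `mₙ / m_d`. -/
def sampleRatio (mn md : ℕ) : ℝ := (mn : ℝ) / md

/-- Two samples: `ω.1 j` is `x_j^{(n)}` and `ω.2 i` is `x_i^{(d)}`. -/
abbrev Samples (X : Type*) (mn md : ℕ) : Type _ := (Fin mn → X) × (Fin md → X)

section Sampling

variable {X : Type*} [MeasurableSpace X] {q mn md : ℕ}

/-- The joint law of an i.i.d. sample of size `mn` from `Pn` and an independent i.i.d. sample of
size `md` from `Pd`. -/
def sampleLaw (Pn Pd : Measure X) (mn md : ℕ) : Measure (Samples X mn md) :=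
  (Measure.pi fun _ : Fin mn => Pn).prod (Measure.pi fun _ : Fin md => Pd)

instance (Pn Pd : Measure X) [IsProbabilityMeasure Pn] [IsProbabilityMeasure Pd] (mn md : ℕ) :
    IsProbabilityMeasure (sampleLaw Pn Pd mn md) := by
  unfold sampleLaw
  infer_instance

/-- The estimating function
`Q_η(θ) = (1/m_d) ∑ r(x_i^{(d)}; θ) η(x_i^{(d)}; θ) - (1/mₙ) ∑ η(x_j^{(n)}; θ)`. -/
def estFun (φ : X → Vec q → ℝ) (η : X → Vec (q + 1) → Vec (q + 1)) (ω : Samples X mn md)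
    (θ : Vec (q + 1)) : Vec (q + 1) :=
  (md : ℝ)⁻¹ • ∑ i, ratio φ (ω.2 i) θ • η (ω.2 i) θ - (mn : ℝ)⁻¹ • ∑ j, η (ω.1 j) θ

/-- The estimator `D̂_f = (1/m_d) ∑ f_d(r(x_i^{(d)}; θ̂)) + (1/mₙ) ∑ f_n(r(x_j^{(n)}; θ̂))`
evaluated at a value `θ` of `θ̂`, with the optimal decomposition and `ρ = mₙ / m_d`. -/
def divEst (f : ℝ → ℝ) (φ : X → Vec q → ℝ) (ω : Samples X mn md) (θ : Vec (q + 1)) : ℝ :=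
  (md : ℝ)⁻¹ * ∑ i, fD f (sampleRatio mn md) (ratio φ (ω.2 i) θ)
    + (mn : ℝ)⁻¹ * ∑ j, fN f (sampleRatio mn md) (ratio φ (ω.1 j) θ)

/-- The statistic `S = m (β̂ - β*)ᵀ V̂ (β̂ - β*)` evaluated at a value `θ` of `θ̂`. -/
def elStat (m : ℝ) (θstar θ : Vec (q + 1)) (V : Matrix (Fin q) (Fin q) ℝ) : ℝ :=
  m * ((betaPart (θ - θstar)).ofLp ⬝ᵥ V.mulVec (betaPart (θ - θstar)).ofLp)

end Sampling

/-- The chi-square distribution with `q` degrees of freedom (for `q ≥ 1`). -/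
def chiSquare (q : ℕ) : Measure ℝ := gammaMeasure ((q : ℝ) / 2) (1 / 2)

/-- The `u`-quantile of the chi-square distribution with `q` degrees of freedom. -/
def chiSquareQuantile (q : ℕ) (u : ℝ) : ℝ := sInf {t : ℝ | u ≤ cdf (chiSquare q) t}

/-- Rejection region of the `D̂_f`-based test of level `a` with estimator `θhat`:
`D̂_f ≥ f''(1) / (2 m) χ²_{d-1}(1 - a)`. -/
def rejectDiv {X : Type*} {q mn md : ℕ} (f : ℝ → ℝ) (φ : X → Vec q → ℝ) (a : ℝ)
    (θhat : Samples X mn md → Vec (q + 1)) : Set (Samples X mn md) :=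
  {ω | deriv (deriv f) 1 / (2 * effSize mn md) * chiSquareQuantile q (1 - a)
    ≤ divEst f φ ω (θhat ω)}

/-- Rejection region of the empirical likelihood test of level `a`: `S > χ²_{d-1}(1 - a)`. -/
def rejectEL {X : Type*} {q mn md : ℕ} (θstar : Vec (q + 1)) (a : ℝ)
    (θhat : Samples X mn md → Vec (q + 1)) (Vhat : Samples X mn md → Matrix (Fin q) (Fin q) ℝ) :
    Set (Samples X mn md) :=
  {ω | chiSquareQuantile q (1 - a) < elStat (effSize mn md) θstar (θhat ω) (Vhat ω)}

/-- Convergence in probability to a constant, for real random variables `Y k` that live on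
probability spaces varying with `k`. -/
def TendstoInProb {Ω : ℕ → Type*} [∀ k, MeasurableSpace (Ω k)] (μ : ∀ k, Measure (Ω k))
    (Y : ∀ k, Ω k → ℝ) (c : ℝ) : Prop :=
  ∀ δ : ℝ, 0 < δ → Tendsto (fun k => μ k {ω | δ < |Y k ω - c|}) atTop (𝓝 0)

end DensityRatio

end

noncomputable section

namespace DensityRatio

section Probability

variable {Ω : ℕ → Type*} [∀ k, MeasurableSpace (Ω k)] {μ : ∀ k, Measure (Ω k)}

open scoped ENNReal

lemma tendstoInProb_iff {Y : ∀ k, Ω k → ℝ} {c : ℝ} :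
    TendstoInProb μ Y c ↔ ∀ δ : ℝ, 0 < δ → ∀ τ : ℝ≥0∞, 0 < τ →
      ∀ᶠ k in atTop, μ k {ω | δ < |Y k ω - c|} ≤ τ := by
  simp only [TendstoInProb, ENNReal.tendsto_nhds_zero, gt_iff_lt]

/-- A sequence that agrees with a convergent one up to `δ` outside of small events converges. -/
lemma TendstoInProb.of_subset {Y : ∀ k, Ω k → ℝ} {c : ℝ}
    (h : ∀ δ : ℝ, 0 < δ → ∀ τ : ℝ≥0∞, 0 < τ → ∃ S : ∀ k, Set (Ω k),
      (∀ᶠ k in atTop, {ω | δ < |Y k ω - c|} ⊆ S k) ∧ ∀ᶠ k in atTop, μ k (S k) ≤ τ) :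
    TendstoInProb μ Y c := by
  rw [tendstoInProb_iff]
  intro δ hδ τ hτ
  obtain ⟨S, hS, hS'⟩ := h δ hδ τ hτ
  filter_upwards [hS, hS'] with k h1 h2
  exact (measure_mono h1).trans h2

lemma TendstoInProb.sub_const {Y : ∀ k, Ω k → ℝ} {c : ℝ} (h : TendstoInProb μ Y c) :
    TendstoInProb μ (fun k ω => Y k ω - c) 0 := by
  simpa [TendstoInProb] using h

lemma TendstoInProb.congr {Y Z : ∀ k, Ω k → ℝ} {c : ℝ} (h : TendstoInProb μ Y c)
    (hYZ : ∀ k, ∀ᵐ ω ∂μ k, Y k ω = Z k ω) : TendstoInProb μ Z c := by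
  intro δ hδ
  refine (h δ hδ).congr fun k => ?_
  apply measure_congr
  filter_upwards [hYZ k] with ω hω
  apply propext
  change δ < |Y k ω - c| ↔ δ < |Z k ω - c|
  rw [hω]

lemma TendstoInProb.of_abs_le {Y Z : ∀ k, Ω k → ℝ} {c : ℝ} (h : TendstoInProb μ Z 0)
    (hYZ : ∀ᶠ k in atTop, ∀ᵐ ω ∂μ k, |Y k ω - c| ≤ |Z k ω|) : TendstoInProb μ Y c := by
  rw [tendstoInProb_iff] at h ⊢
  intro δ hδ τ hτ
  filter_upwards [h δ hδ τ hτ, hYZ] with k h1 h2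
  refine (measure_mono_ae ?_).trans h1
  filter_upwards [h2] with ω hω hω'
  simp only [sub_zero]
  exact lt_of_lt_of_le hω' hω

lemma TendstoInProb.add {Y Z : ∀ k, Ω k → ℝ} {c d : ℝ} (hY : TendstoInProb μ Y c)
    (hZ : TendstoInProb μ Z d) : TendstoInProb μ (fun k ω => Y k ω + Z k ω) (c + d) := by
  rw [tendstoInProb_iff] at hY hZ ⊢
  intro δ hδ τ hτ
  have hτ2 : 0 < τ / 2 := ENNReal.half_pos hτ.ne'
  filter_upwards [hY (δ / 2) (half_pos hδ) (τ / 2) hτ2, hZ (δ / 2) (half_pos hδ) (τ / 2) hτ2]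
    with k h1 h2
  calc _ ≤ μ k ({ω | δ / 2 < |Y k ω - c|} ∪ {ω | δ / 2 < |Z k ω - d|}) := by
        refine measure_mono fun ω hω => ?_
        simp only [Set.mem_ofPred_eq, Set.mem_union] at hω ⊢
        by_contra! hcon
        have := abs_add_le (Y k ω - c) (Z k ω - d)
        rw [show Y k ω + Z k ω - (c + d) = Y k ω - c + (Z k ω - d) by ring] at hω
        linarith
    _ ≤ τ / 2 + τ / 2 := (measure_union_le _ _).trans (add_le_add h1 h2)
    _ = τ := ENNReal.add_halves τ

lemma TendstoInProb.const_mul {Y : ∀ k, Ω k → ℝ} {c : ℝ} (hY : TendstoInProb μ Y c) (a : ℝ) :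
    TendstoInProb μ (fun k ω => a * Y k ω) (a * c) := by
  rw [tendstoInProb_iff] at hY ⊢
  intro δ hδ τ hτ
  filter_upwards [hY (δ / (|a| + 1)) (by positivity) τ hτ] with k h1
  refine (measure_mono fun ω hω => ?_).trans h1
  simp only [Set.mem_ofPred_eq] at hω ⊢
  rw [← mul_sub, abs_mul] at hω
  rw [div_lt_iff₀ (by positivity)]
  nlinarith [abs_nonneg (Y k ω - c), abs_nonneg a]

lemma TendstoInProb.sub {Y Z : ∀ k, Ω k → ℝ} {c d : ℝ} (hY : TendstoInProb μ Y c)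
    (hZ : TendstoInProb μ Z d) : TendstoInProb μ (fun k ω => Y k ω - Z k ω) (c - d) := by
  have := hY.add (hZ.const_mul (-1))
  simpa [sub_eq_add_neg] using this

lemma tendstoInProb_const (c : ℝ) : TendstoInProb μ (fun _ _ => c) c := by
  intro δ hδ
  simp [not_lt.2 hδ.le]

lemma tendstoInProb_of_tendsto {u : ℕ → ℝ} {c : ℝ} (hu : Tendsto u atTop (𝓝 c)) :
    TendstoInProb μ (fun k _ => u k) c := by
  refine TendstoInProb.of_subset fun δ hδ τ _ => ⟨fun _ => ∅, ?_, by simp⟩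
  filter_upwards [Metric.tendsto_nhds.1 hu δ hδ] with k hk ω hω
  exact absurd hω (not_lt.2 hk.le)

lemma TendstoInProb.sum {ι : Type*} (I : Finset ι) {Y : ι → ∀ k, Ω k → ℝ} {c : ι → ℝ}
    (hY : ∀ i ∈ I, TendstoInProb μ (Y i) (c i)) :
    TendstoInProb μ (fun k ω => ∑ i ∈ I, Y i k ω) (∑ i ∈ I, c i) := by
  classical
  induction I using Finset.induction_on with
  | empty => simpa using tendstoInProb_const (μ := μ) 0
  | insert i I hi ih =>
    simp only [Finset.sum_insert hi]
    exact (hY i (Finset.mem_insert_self _ _)).add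
      (ih fun j hj => hY j (Finset.mem_insert_of_mem hj))

/-- Boundedness in probability of a sequence of real random variables. -/
def BoundedInProb (μ : ∀ k, Measure (Ω k)) (Y : ∀ k, Ω k → ℝ) : Prop :=
  ∀ τ : ℝ≥0∞, 0 < τ → ∃ K : ℝ, 0 < K ∧ ∀ᶠ k in atTop, μ k {ω | K < |Y k ω|} ≤ τ

lemma TendstoInProb.mul_bounded {Y Z : ∀ k, Ω k → ℝ} (hY : TendstoInProb μ Y 0)
    (hZ : BoundedInProb μ Z) : TendstoInProb μ (fun k ω => Y k ω * Z k ω) 0 := by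
  rw [tendstoInProb_iff] at hY ⊢
  intro δ hδ τ hτ
  have hτ2 : 0 < τ / 2 := ENNReal.half_pos hτ.ne'
  obtain ⟨K, hK, hZK⟩ := hZ (τ / 2) hτ2
  filter_upwards [hY (δ / K) (by positivity) (τ / 2) hτ2, hZK] with k h1 h2
  calc _ ≤ μ k ({ω | δ / K < |Y k ω - 0|} ∪ {ω | K < |Z k ω|}) := by
        refine measure_mono fun ω hω => ?_
        simp only [Set.mem_ofPred_eq, Set.mem_union, sub_zero, abs_mul] at hω ⊢
        by_contra! hcon
        have := mul_le_mul hcon.1 hcon.2 (abs_nonneg _) (by positivity)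
        rw [div_mul_cancel₀ _ hK.ne'] at this
        linarith
    _ ≤ τ / 2 + τ / 2 := (measure_union_le _ _).trans (add_le_add h1 h2)
    _ = τ := ENNReal.add_halves τ

lemma BoundedInProb.of_abs_le {Y Z : ∀ k, Ω k → ℝ} (hZ : BoundedInProb μ Z) {a b : ℝ} (ha : 0 ≤ a)
    (hb : 0 ≤ b) (h : ∀ᶠ k in atTop, ∀ ω, |Y k ω| ≤ a * |Z k ω| + b) : BoundedInProb μ Y := by
  intro τ hτ
  obtain ⟨K, hK, hZK⟩ := hZ τ hτ
  refine ⟨a * K + b + 1, by positivity, ?_⟩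
  filter_upwards [h, hZK] with k h1 h2
  refine (measure_mono fun ω hω => ?_).trans h2
  simp only [Set.mem_ofPred_eq] at hω ⊢
  by_contra! hcon
  have := mul_le_mul_of_nonneg_left hcon ha
  linarith [h1 ω]

lemma BoundedInProb.mul_self {Y : ∀ k, Ω k → ℝ} (hY : BoundedInProb μ Y) :
    BoundedInProb μ (fun k ω => Y k ω ^ 2) := by
  intro τ hτ
  obtain ⟨K, hK, hYK⟩ := hY τ hτ
  refine ⟨K ^ 2, by positivity, ?_⟩
  filter_upwards [hYK] with k h2
  refine (measure_mono fun ω hω => ?_).trans h2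
  simp only [Set.mem_ofPred_eq, abs_pow] at hω ⊢
  exact lt_of_pow_lt_pow_left₀ 2 (abs_nonneg _) hω

lemma TendstoInProb.add_boundedInProb {Y Z : ∀ k, Ω k → ℝ} (hY : BoundedInProb μ Y)
    (hZ : TendstoInProb μ (fun k ω => Z k ω - Y k ω) 0) : BoundedInProb μ Z := by
  intro τ hτ
  have hτ2 : 0 < τ / 2 := ENNReal.half_pos hτ.ne'
  obtain ⟨K, hK, hYK⟩ := hY (τ / 2) hτ2
  refine ⟨K + 1, by positivity, ?_⟩
  filter_upwards [hYK, tendstoInProb_iff.1 hZ 1 one_pos (τ / 2) hτ2] with k h1 h2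
  calc _ ≤ μ k ({ω | K < |Y k ω|} ∪ {ω | 1 < |Z k ω - Y k ω - 0|}) := by
        refine measure_mono fun ω hω => ?_
        simp only [Set.mem_ofPred_eq, Set.mem_union, sub_zero] at hω ⊢
        by_contra! hcon
        have := abs_sub_abs_le_abs_sub (Z k ω) (Y k ω)
        linarith
    _ ≤ τ / 2 + τ / 2 := (measure_union_le _ _).trans (add_le_add h1 h2)
    _ = τ := ENNReal.add_halves τ

section Distribution

variable [∀ k, IsProbabilityMeasure (μ k)] {Ω' : Type*} [MeasurableSpace Ω'] {μ' : Measure Ω'}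
  [IsProbabilityMeasure μ']

lemma eventually_measure_closed_le {E : Type*} [TopologicalSpace E] [MeasurableSpace E]
    [OpensMeasurableSpace E] [HasOuterApproxClosed E] {X : ∀ k, Ω k → E} {Z : Ω' → E}
    (h : TendstoInDistribution X atTop Z μ μ') {C : Set E} (hC : IsClosed C) {τ : ℝ≥0∞}
    (hτ : 0 < τ) : ∀ᶠ k in atTop, μ k (X k ⁻¹' C) ≤ μ' (Z ⁻¹' C) + τ := by
  have := ProbabilityMeasure.limsup_measure_closed_le_of_tendsto h.tendsto hC
  simp only [ProbabilityMeasure.coe_mk] at this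
  rw [Measure.map_apply_of_aemeasurable h.aemeasurable_limit hC.measurableSet] at this
  have h2 := eventually_lt_of_limsup_lt
    (this.trans_lt (ENNReal.lt_add_right (measure_ne_top μ' (Z ⁻¹' C)) hτ.ne'))
  filter_upwards [h2] with k hk
  rw [Measure.map_apply_of_aemeasurable (h.forall_aemeasurable k) hC.measurableSet] at hk
  exact hk.le

lemma eventually_le_measure_open {E : Type*} [TopologicalSpace E] [MeasurableSpace E]
    [OpensMeasurableSpace E] [HasOuterApproxClosed E] {X : ∀ k, Ω k → E} {Z : Ω' → E}
    (h : TendstoInDistribution X atTop Z μ μ') {O : Set E} (hO : IsOpen O) {τ : ℝ≥0∞}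
    (hτ : 0 < τ) : ∀ᶠ k in atTop, μ' (Z ⁻¹' O) ≤ μ k (X k ⁻¹' O) + τ := by
  have := ProbabilityMeasure.le_liminf_measure_open_of_tendsto h.tendsto hO
  simp only [ProbabilityMeasure.coe_mk] at this
  rw [Measure.map_apply_of_aemeasurable h.aemeasurable_limit hO.measurableSet] at this
  rcases eq_or_ne (μ' (Z ⁻¹' O)) 0 with h0 | h0
  · simp [h0]
  have h2 := eventually_lt_of_lt_liminf
    ((ENNReal.sub_lt_self (measure_ne_top μ' (Z ⁻¹' O)) h0 hτ.ne').trans_le this)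
  filter_upwards [h2] with k hk
  rw [Measure.map_apply_of_aemeasurable (h.forall_aemeasurable k) hO.measurableSet] at hk
  exact tsub_le_iff_right.1 hk.le

lemma boundedInProb_norm {E : Type*} [NormedAddCommGroup E] [MeasurableSpace E]
    [BorelSpace E] {X : ∀ k, Ω k → E} {Z : Ω' → E}
    (h : TendstoInDistribution X atTop Z μ μ') : BoundedInProb μ (fun k ω => ‖X k ω‖) := by
  intro τ hτ
  have hτ2 : 0 < τ / 2 := ENNReal.half_pos hτ.ne'
  have hlim : Tendsto (fun n : ℕ => μ' (Z ⁻¹' {z | (n : ℝ) ≤ ‖z‖})) atTop (𝓝 0) := by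
    have : (0 : ℝ≥0∞) = μ' (⋂ n : ℕ, Z ⁻¹' {z | (n : ℝ) ≤ ‖z‖}) := by
      have : (⋂ n : ℕ, Z ⁻¹' {z | (n : ℝ) ≤ ‖z‖}) = ∅ := by
        ext ω
        simp only [Set.mem_iInter, Set.mem_preimage, Set.mem_ofPred_eq, Set.mem_empty_iff_false,
          iff_false, not_forall, not_le]
        exact exists_nat_gt _
      rw [this, measure_empty]
    rw [this]
    refine tendsto_measure_iInter_atTop (fun n => ?_) ?_ ⟨0, measure_ne_top _ _⟩
    · exact h.aemeasurable_limit.nullMeasurableSet_preimage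
        (isClosed_le continuous_const continuous_norm).measurableSet
    · intro a b hab ω hω
      simp only [Set.mem_preimage, Set.mem_ofPred_eq] at hω ⊢
      exact le_trans (by exact_mod_cast hab) hω
  obtain ⟨n, hn⟩ := (ENNReal.tendsto_nhds_zero.1 hlim (τ / 2) hτ2).exists
  refine ⟨n + 1, by positivity, ?_⟩
  filter_upwards [eventually_measure_closed_le h
    (isClosed_le (continuous_const (y := (n : ℝ))) continuous_norm) hτ2] with k hk
  calc _ ≤ μ k (X k ⁻¹' {z | (n : ℝ) ≤ ‖z‖}) := by
        refine measure_mono fun ω hω => ?_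
        simp only [Set.mem_ofPred_eq, abs_norm, Set.mem_preimage] at hω ⊢
        linarith
    _ ≤ τ / 2 + τ / 2 := hk.trans (add_le_add hn le_rfl)
    _ = τ := ENNReal.add_halves τ

/-- **Slutsky's theorem** at a continuity point of the limit law: if `X k` converges in
distribution to `Z` and `R k - X k` to `0` in probability, then the probabilities of events between
`{c < R k}` and `{c ≤ R k}` converge, provided that `c` is not an atom of the law of `Z`. -/
lemma tendsto_measureReal_of_tendstoInDistribution {X : ∀ k, Ω k → ℝ} {Z : Ω' → ℝ}
    (h : TendstoInDistribution X atTop Z μ μ') {R : ∀ k, Ω k → ℝ}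
    (hR : TendstoInProb μ (fun k ω => R k ω - X k ω) 0) {c : ℝ} (hc : μ' {ω | Z ω = c} = 0)
    {A : ∀ k, Set (Ω k)} (hA : ∀ᶠ k in atTop, {ω | c < R k ω} ⊆ A k)
    (hA' : ∀ᶠ k in atTop, A k ⊆ {ω | c ≤ R k ω}) :
    Tendsto (fun k => (μ k).real (A k)) atTop (𝓝 (μ'.real {ω | c ≤ Z ω})) := by
  rw [tendstoInProb_iff] at hR
  have hδ : ∀ n : ℕ, (0 : ℝ) < 1 / ((n : ℝ) + 1) := fun n => Nat.one_div_pos_of_nat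
  have hδ_anti : ∀ a b : ℕ, a ≤ b → 1 / ((b : ℝ) + 1) ≤ 1 / ((a : ℝ) + 1) := fun a b hab =>
    Nat.one_div_le_one_div hab
  have hupper : Tendsto (fun n : ℕ => μ' (Z ⁻¹' Set.Ici (c - 1 / ((n : ℝ) + 1)))) atTop
      (𝓝 (μ' {ω | c ≤ Z ω})) := by
    have : {ω | c ≤ Z ω} = ⋂ n : ℕ, Z ⁻¹' Set.Ici (c - 1 / ((n : ℝ) + 1)) := by
      ext ω
      simp only [Set.mem_iInter, Set.mem_preimage, Set.mem_ofPred_eq, Set.mem_Ici]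
      refine ⟨fun hω n => by linarith [hδ n], fun hω => le_of_forall_pos_le_add fun δ hδ' => ?_⟩
      obtain ⟨n, hn⟩ := exists_nat_one_div_lt hδ'
      linarith [hω n]
    rw [this]
    refine tendsto_measure_iInter_atTop (fun n => ?_) ?_ ⟨0, measure_ne_top _ _⟩
    · exact h.aemeasurable_limit.nullMeasurableSet_preimage measurableSet_Ici
    · intro a b hab ω hω
      simp only [Set.mem_preimage, Set.mem_Ici] at hω ⊢
      linarith [hδ_anti a b hab]
  have hlower : Tendsto (fun n : ℕ => μ' (Z ⁻¹' Set.Ioi (c + 1 / ((n : ℝ) + 1)))) atTop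
      (𝓝 (μ' {ω | c ≤ Z ω})) := by
    have h1 : μ' {ω | c ≤ Z ω} = μ' {ω | c < Z ω} := by
      refine le_antisymm ?_ (measure_mono fun ω (hω : c < Z ω) => show c ≤ Z ω from hω.le)
      calc μ' {ω | c ≤ Z ω} ≤ μ' ({ω | c < Z ω} ∪ {ω | Z ω = c}) := by
            refine measure_mono fun ω hω => ?_
            exact (lt_or_eq_of_le (show c ≤ Z ω from hω)).imp id Eq.symm
        _ ≤ _ := (measure_union_le _ _).trans (by rw [hc, add_zero])
    have : {ω | c < Z ω} = ⋃ n : ℕ, Z ⁻¹' Set.Ioi (c + 1 / ((n : ℝ) + 1)) := by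
      ext ω
      simp only [Set.mem_iUnion, Set.mem_preimage, Set.mem_ofPred_eq, Set.mem_Ioi]
      refine ⟨fun hω => ?_, fun ⟨n, hn⟩ => by linarith [hδ n]⟩
      obtain ⟨n, hn⟩ := exists_nat_one_div_lt (sub_pos.2 hω)
      exact ⟨n, by linarith⟩
    rw [h1, this]
    refine tendsto_measure_iUnion_atTop ?_
    intro a b hab ω hω
    simp only [Set.mem_preimage, Set.mem_Ioi] at hω ⊢
    linarith [hδ_anti a b hab]
  refine (ENNReal.tendsto_toReal (measure_ne_top μ' _)).comp ?_
  rw [ENNReal.tendsto_nhds (measure_ne_top μ' _)]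
  intro τ hτ
  have hτ3 : 0 < τ / 3 := ENNReal.div_pos hτ.ne' (by simp)
  have hsum : τ / 3 + τ / 3 + τ / 3 = τ := ENNReal.add_thirds τ
  obtain ⟨n, hn⟩ :=
    ((ENNReal.tendsto_nhds (measure_ne_top μ' _)).1 hupper (τ / 3) hτ3).exists
  obtain ⟨n', hn'⟩ :=
    ((ENNReal.tendsto_nhds (measure_ne_top μ' _)).1 hlower (τ / 3) hτ3).exists
  filter_upwards [hA, hA', eventually_measure_closed_le h (isClosed_Ici (a := c - 1 / (n + 1))) hτ3,
    eventually_le_measure_open h (isOpen_Ioi (a := c + 1 / (n' + 1))) hτ3,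
    hR _ (hδ n) _ hτ3, hR _ (hδ n') _ hτ3] with k h1 h2 h3 h4 h5 h6
  constructor
  · rw [tsub_le_iff_right]
    have h7 : μ k (X k ⁻¹' Set.Ioi (c + 1 / (n' + 1))) ≤ μ k (A k) + τ / 3 := by
      refine le_trans ?_ (add_le_add le_rfl h6)
      refine (measure_mono fun ω hω => ?_).trans (measure_union_le _ _)
      by_cases hω' : c < R k ω
      · exact Or.inl (h1 hω')
      · right
        simp only [Set.mem_preimage, Set.mem_Ioi, Set.mem_ofPred_eq, sub_zero] at hω ⊢
        have := neg_abs_le (R k ω - X k ω)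
        linarith
    calc μ' {ω | c ≤ Z ω} ≤ μ' (Z ⁻¹' Set.Ioi (c + 1 / ((n' : ℝ) + 1))) + τ / 3 :=
          tsub_le_iff_right.1 hn'.1
      _ ≤ μ k (A k) + τ / 3 + τ / 3 + τ / 3 := by gcongr; exact h4.trans (by gcongr)
      _ = μ k (A k) + τ := by rw [add_assoc, add_assoc, ← add_assoc (τ / 3), hsum]
  · have h7 : μ k (A k) ≤ μ k (X k ⁻¹' Set.Ici (c - 1 / (n + 1))) + τ / 3 := by
      refine le_trans ?_ (add_le_add le_rfl h5)
      refine (measure_mono fun ω hω => ?_).trans (measure_union_le _ _)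
      have hω2 := h2 hω
      simp only [Set.mem_preimage, Set.mem_Ici, Set.mem_ofPred_eq, sub_zero, Set.mem_union] at hω2 ⊢
      by_contra! hcon
      have := le_abs_self (R k ω - X k ω)
      linarith
    calc μ k (A k) ≤ μ k (X k ⁻¹' Set.Ici (c - 1 / (n + 1))) + τ / 3 := h7
      _ ≤ μ' {ω | c ≤ Z ω} + τ / 3 + τ / 3 + τ / 3 := by
          gcongr; exact h3.trans (by gcongr; exact hn.2)
      _ = _ := by rw [add_assoc, add_assoc, ← add_assoc (τ / 3), hsum]

end Distribution

end Probability

section LawOfLargeNumbers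

open scoped ENNReal

variable {X : Type*}

/-- The average of `g` over a sample. -/
def sampleMean {n : ℕ} (g : X → ℝ) (ξ : Fin n → X) : ℝ := (n : ℝ)⁻¹ * ∑ j, g (ξ j)

lemma sampleMean_add {n : ℕ} (g g' : X → ℝ) (ξ : Fin n → X) :
    sampleMean (fun x => g x + g' x) ξ = sampleMean g ξ + sampleMean g' ξ := by
  simp [sampleMean, Finset.sum_add_distrib, mul_add]

lemma sampleMean_sub {n : ℕ} (g g' : X → ℝ) (ξ : Fin n → X) :
    sampleMean (fun x => g x - g' x) ξ = sampleMean g ξ - sampleMean g' ξ := by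
  simp [sampleMean, Finset.sum_sub_distrib, mul_sub]

lemma sampleMean_const_mul {n : ℕ} (c : ℝ) (g : X → ℝ) (ξ : Fin n → X) :
    sampleMean (fun x => c * g x) ξ = c * sampleMean g ξ := by
  simp only [sampleMean, ← Finset.mul_sum]; ring

lemma sampleMean_sum {n : ℕ} {ι : Type*} (I : Finset ι) (g : ι → X → ℝ) (ξ : Fin n → X) :
    sampleMean (fun x => ∑ i ∈ I, g i x) ξ = ∑ i ∈ I, sampleMean (g i) ξ := by
  simp only [sampleMean, ← Finset.mul_sum]
  rw [Finset.sum_comm]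

lemma sampleMean_mono {n : ℕ} {g g' : X → ℝ} {ξ : Fin n → X} (h : ∀ j, g (ξ j) ≤ g' (ξ j)) :
    sampleMean g ξ ≤ sampleMean g' ξ :=
  mul_le_mul_of_nonneg_left (Finset.sum_le_sum fun j _ => h j) (by positivity)

lemma abs_sampleMean_le {n : ℕ} {g g' : X → ℝ} {ξ : Fin n → X} (h : ∀ j, |g (ξ j)| ≤ g' (ξ j)) :
    |sampleMean g ξ| ≤ sampleMean g' ξ := by
  rw [sampleMean, abs_mul, abs_of_nonneg (by positivity : (0 : ℝ) ≤ (n : ℝ)⁻¹)]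
  exact mul_le_mul_of_nonneg_left
    ((Finset.abs_sum_le_sum_abs _ _).trans (Finset.sum_le_sum fun j _ => h j)) (by positivity)

lemma sampleMean_nonneg {n : ℕ} {g : X → ℝ} {ξ : Fin n → X} (h : ∀ j, 0 ≤ g (ξ j)) :
    0 ≤ sampleMean g ξ :=
  mul_nonneg (by positivity) (Finset.sum_nonneg fun j _ => h j)

variable [MeasurableSpace X]

lemma measurable_sampleMean {n : ℕ} {g : X → ℝ} (hg : Measurable g) :
    Measurable (sampleMean (n := n) g) :=
  measurable_const.mul (Finset.measurable_sum _ fun j _ => hg.comp (measurable_pi_apply j))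

lemma integrable_sampleMean {n : ℕ} {Q : Measure X} [IsProbabilityMeasure Q] {g : X → ℝ}
    (hg : Integrable g Q) : Integrable (sampleMean (n := n) g) (Measure.pi fun _ => Q) :=
  (integrable_finsetSum _ fun _ _ => integrable_comp_eval hg).const_mul _

lemma integral_sampleMean {n : ℕ} (hn : 0 < n) {Q : Measure X} [IsProbabilityMeasure Q] {g : X → ℝ}
    (hg : Integrable g Q) :
    ∫ ξ, sampleMean (n := n) g ξ ∂(Measure.pi fun _ => Q) = ∫ x, g x ∂Q := by
  have hn' : (n : ℝ) ≠ 0 := by positivity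
  simp only [sampleMean]
  rw [integral_const_mul, integral_finsetSum _ fun j _ => integrable_comp_eval hg]
  have : ∀ j : Fin n, ∫ ξ : Fin n → X, g (ξ j) ∂(Measure.pi fun _ => Q) = ∫ x, g x ∂Q := fun j =>
    integral_comp_eval (μ := fun _ : Fin n => Q) hg.1
  simp only [this, Finset.sum_const, Finset.card_univ, Fintype.card_fin, nsmul_eq_mul]
  rw [← mul_assoc, inv_mul_cancel₀ hn', one_mul]

lemma variance_sampleMean {n : ℕ} {Q : Measure X} [IsProbabilityMeasure Q]
    {g : X → ℝ} (hg : MemLp g 2 Q) :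
    variance (sampleMean (n := n) g) (Measure.pi fun _ => Q) = (n : ℝ)⁻¹ * variance g Q := by
  have h1 : sampleMean (n := n) g = fun ξ => (n : ℝ)⁻¹ * (∑ j, fun ξ : Fin n → X => g (ξ j)) ξ := by
    ext ξ; simp [sampleMean]
  rw [h1, variance_const_mul]
  have := variance_sum_pi (μ := fun _ : Fin n => Q) (X := fun _ => g) fun _ => hg
  rw [this]
  simp only [Finset.sum_const, Finset.card_univ, Fintype.card_fin, nsmul_eq_mul]
  rcases eq_or_ne (n : ℝ) 0 with h | h
  · simp [h]
  · field_simp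

/-- Random samples `ξ k` which asymptotically behave like samples from `P`, as far as averages of
bounded functions are concerned. -/
structure AsymptoticSample (P : Measure X) {Ω : ℕ → Type*} [∀ k, MeasurableSpace (Ω k)]
    (μ : ∀ k, Measure (Ω k)) {n : ℕ → ℕ} (ξ : ∀ k, Ω k → Fin (n k) → X) : Prop where
  ae_forall : ∀ p : X → Prop, (∀ᵐ x ∂P, p x) → ∀ k, ∀ᵐ ω ∂μ k, ∀ j, p (ξ k ω j)
  tendsto_of_bounded : ∀ g : X → ℝ, Measurable g → (∃ C, ∀ x, |g x| ≤ C) →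
    TendstoInProb μ (fun k ω => sampleMean g (ξ k ω)) (∫ x, g x ∂P)

variable {P : Measure X} {Ω : ℕ → Type*} [∀ k, MeasurableSpace (Ω k)] {μ : ∀ k, Measure (Ω k)}
  {n : ℕ → ℕ} {ξ : ∀ k, Ω k → Fin (n k) → X}

lemma tendsto_integral_sub_min [IsProbabilityMeasure P] {B : X → ℝ} (hB : Measurable B)
    (hBint : Integrable B P) :
    Tendsto (fun K : ℕ => ∫ x, (B x - max (-(K : ℝ)) (min (B x) K)) ∂P) atTop (𝓝 0) := by
  have : (0 : ℝ) = ∫ _, (0 : ℝ) ∂P := by simp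
  rw [this]
  refine tendsto_integral_of_dominated_convergence (fun x => |B x|) (fun K => ?_) hBint.abs
    (fun K => ae_of_all _ fun x => ?_) (ae_of_all _ fun x => ?_)
  · exact (hB.sub (measurable_const.max (hB.min measurable_const))).aestronglyMeasurable
  · have hK : (0 : ℝ) ≤ K := by positivity
    rw [Real.norm_eq_abs]
    rcases le_total (B x) K with h1 | h1 <;> rcases le_total (-(K : ℝ)) (B x) with h2 | h2 <;>
      rcases abs_cases (B x) with h3 | h3 <;> grind
  · refine tendsto_const_nhds.congr' ?_
    obtain ⟨N, hN⟩ := exists_nat_ge |B x|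
    filter_upwards [eventually_ge_atTop N] with K hK
    have : |B x| ≤ K := hN.trans (by exact_mod_cast hK)
    rw [abs_le] at this
    rw [min_eq_left this.2, max_eq_right this.1, sub_self]

/-- Weak law of large numbers for functions dominated by a function which satisfies it. -/
lemma AsymptoticSample.tendsto_of_dominated [IsProbabilityMeasure P] (h : AsymptoticSample P μ ξ)
    {w B : X → ℝ} (hw : Measurable w) (hB : Measurable B) (hBint : Integrable B P)
    (hBlln : TendstoInProb μ (fun k ω => sampleMean B (ξ k ω)) (∫ x, B x ∂P))
    (hwB : ∀ᵐ x ∂P, 0 ≤ w x ∧ w x ≤ B x) :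
    TendstoInProb μ (fun k ω => sampleMean w (ξ k ω)) (∫ x, w x ∂P) := by
  have hwint : Integrable w P := hBint.mono' hw.aestronglyMeasurable <| by
    filter_upwards [hwB] with x hx
    rw [Real.norm_eq_abs, abs_of_nonneg hx.1]
    exact hx.2
  have htrunc : ∀ (g : X → ℝ), Measurable g → ∀ K : ℕ,
      TendstoInProb μ (fun k ω => sampleMean (fun x => max (-(K : ℝ)) (min (g x) K)) (ξ k ω))
        (∫ x, max (-(K : ℝ)) (min (g x) K) ∂P) := fun g hg K =>
    h.tendsto_of_bounded _ (measurable_const.max (hg.min measurable_const))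
      ⟨K, fun x => abs_le.2 ⟨le_max_left _ _, max_le (by simp) (min_le_right _ _)⟩⟩
  have htrunc_int : ∀ (g : X → ℝ), Measurable g → ∀ K : ℕ,
      Integrable (fun x => max (-(K : ℝ)) (min (g x) K)) P := fun g hg K =>
    Integrable.of_bound (measurable_const.max (hg.min measurable_const)).aestronglyMeasurable K
      (ae_of_all _ fun x => by
        rw [Real.norm_eq_abs]
        exact abs_le.2 ⟨le_max_left _ _, max_le (by simp) (min_le_right _ _)⟩)
  have hcmp : ∀ᵐ x ∂P, ∀ K : ℕ, 0 ≤ w x - max (-(K : ℝ)) (min (w x) K) ∧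
      w x - max (-(K : ℝ)) (min (w x) K) ≤ B x - max (-(K : ℝ)) (min (B x) K) := by
    filter_upwards [hwB] with x hx K
    have hK : (0 : ℝ) ≤ K := by positivity
    rcases le_total (B x) K with h1 | h1 <;> rcases le_total (w x) K with h2 | h2 <;> grind
  rw [tendstoInProb_iff]
  intro δ hδ τ hτ
  obtain ⟨K, hK⟩ := ((tendsto_order.1 (tendsto_integral_sub_min hB hBint)).2 (δ / 4)
    (by positivity)).exists
  have hB' := (hBlln.sub (htrunc B hB K))
  rw [← integral_sub hBint (htrunc_int B hB K)] at hB'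
  have hτ2 : 0 < τ / 2 := ENNReal.half_pos hτ.ne'
  have hIw : ∫ x, w x ∂P - ∫ x, max (-(K : ℝ)) (min (w x) K) ∂P
      ≤ ∫ x, (B x - max (-(K : ℝ)) (min (B x) K)) ∂P := by
    rw [← integral_sub hwint (htrunc_int w hw K)]
    refine integral_mono_ae (hwint.sub (htrunc_int w hw K)) (hBint.sub (htrunc_int B hB K)) ?_
    filter_upwards [hcmp] with x hx using (hx K).2
  have hIw0 : 0 ≤ ∫ x, w x ∂P - ∫ x, max (-(K : ℝ)) (min (w x) K) ∂P := by
    rw [← integral_sub hwint (htrunc_int w hw K)]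
    refine integral_nonneg_of_ae ?_
    filter_upwards [hcmp] with x hx using (hx K).1
  filter_upwards [tendstoInProb_iff.1 hB' (δ / 4) (by positivity) _ hτ2,
    tendstoInProb_iff.1 (htrunc w hw K) (δ / 4) (by positivity) _ hτ2] with k h1 h2
  refine le_trans ?_ ((add_le_add h1 h2).trans (ENNReal.add_halves τ).le)
  refine le_trans (measure_mono_ae ?_) (measure_union_le _ _)
  filter_upwards [h.ae_forall _ hcmp k] with ω hω hω'
  change δ < |sampleMean w (ξ k ω) - ∫ x, w x ∂P| at hω'
  by_contra hcon
  have hcon' := not_or.1 hcon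
  simp only [Set.mem_ofPred_eq, not_lt] at hcon'
  obtain ⟨c1, c2⟩ := hcon'
  have e1 : sampleMean w (ξ k ω) - sampleMean (fun x => max (-(K : ℝ)) (min (w x) K)) (ξ k ω)
      ≤ sampleMean B (ξ k ω) - sampleMean (fun x => max (-(K : ℝ)) (min (B x) K)) (ξ k ω) := by
    rw [← sampleMean_sub, ← sampleMean_sub]
    exact sampleMean_mono fun j => (hω j K).2
  have e2 : 0 ≤ sampleMean w (ξ k ω)
      - sampleMean (fun x => max (-(K : ℝ)) (min (w x) K)) (ξ k ω) := by
    rw [← sampleMean_sub]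
    exact sampleMean_nonneg fun j => (hω j K).1
  rw [abs_le] at c1 c2
  rw [lt_abs] at hω'
  rcases hω' with hω' | hω' <;> linarith [c1.1, c1.2, c2.1, c2.2]

lemma tendstoInProb_of_measurePreserving {Ω' : ℕ → Type*} [∀ k, MeasurableSpace (Ω' k)]
    {ν : ∀ k, Measure (Ω' k)} {F : ∀ k, Ω k → Ω' k} (hF : ∀ k, MeasurePreserving (F k) (μ k) (ν k))
    {Y : ∀ k, Ω' k → ℝ} {c : ℝ} (h : TendstoInProb ν Y c) :
    TendstoInProb μ (fun k ω => Y k (F k ω)) c := by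
  rw [tendstoInProb_iff] at h ⊢
  intro δ hδ τ hτ
  filter_upwards [h δ hδ τ hτ] with k hk
  refine le_trans ?_ hk
  rw [← (hF k).map_eq]
  exact Measure.le_map_apply (hF k).measurable.aemeasurable _

/-- I.i.d. samples from laws `Q k` which converge to `P` in total variation. -/
lemma asymptoticSample_of_tendsto {Q : ℕ → Measure X} [∀ k, IsProbabilityMeasure (Q k)]
    (hQ : ∀ k, Q k ≪ P) (hn : Tendsto n atTop atTop) (hn0 : ∀ k, 0 < n k)
    (hlim : ∀ g : X → ℝ, Measurable g → (∃ C, ∀ x, |g x| ≤ C) →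
      Tendsto (fun k => ∫ x, g x ∂Q k) atTop (𝓝 (∫ x, g x ∂P)))
    (hξ : ∀ k, MeasurePreserving (ξ k) (μ k) (Measure.pi fun _ => Q k)) :
    AsymptoticSample P μ ξ := by
  refine ⟨fun p hp k => ?_, fun g hg ⟨C, hC⟩ => ?_⟩
  · refine (hξ k).quasiMeasurePreserving.ae (p := fun η => ∀ j, p (η j)) ?_
    rw [ae_all_iff]
    intro j
    exact (measurePreserving_eval (fun _ : Fin (n k) => Q k) j).quasiMeasurePreserving.ae
      ((hQ k).ae_le hp)
  · refine tendstoInProb_of_measurePreserving hξ (Y := fun k η => sampleMean g η) ?_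
    have hint : ∀ k, MemLp g 2 (Q k) := fun k =>
      MemLp.of_bound hg.aestronglyMeasurable C (ae_of_all _ hC)
    have hmem : ∀ k, MemLp (sampleMean (n := n k) g) 2 (Measure.pi fun _ => Q k) := fun k =>
      MemLp.of_bound (measurable_sampleMean hg).aestronglyMeasurable C (ae_of_all _ fun η => by
        refine (abs_sampleMean_le (g' := fun _ => C) fun j => hC _).trans ?_
        have hn' : (n k : ℝ) ≠ 0 := by exact_mod_cast (hn0 k).ne'
        simp [sampleMean, inv_mul_cancel_left₀ hn'])
    have h0 : TendstoInProb (fun k => Measure.pi fun _ : Fin (n k) => Q k)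
        (fun k η => sampleMean g η - ∫ x, g x ∂Q k) 0 := by
      intro δ hδ
      have hbound : ∀ k, (Measure.pi fun _ : Fin (n k) => Q k)
          {η | δ < |sampleMean g η - ∫ x, g x ∂Q k - 0|}
            ≤ ENNReal.ofReal ((n k : ℝ)⁻¹ * (C ^ 2 / δ ^ 2)) := by
        intro k
        have := meas_ge_le_variance_div_sq (hmem k) hδ
        rw [integral_sampleMean (hn0 k) ((hint k).integrable (by norm_num)),
          variance_sampleMean (hint k)] at this
        refine (measure_mono fun η (hη : δ < _) => ?_).trans
          (this.trans (ENNReal.ofReal_le_ofReal ?_))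
        · rw [sub_zero] at hη
          exact hη.le
        · rw [mul_div_assoc]
          gcongr
          have h4 := variance_le_sq_of_bounded (μ := Q k) (a := -C) (b := C) (X := g)
            (ae_of_all _ fun x => abs_le.1 (hC x)) hg.aemeasurable
          refine h4.trans (le_of_eq ?_)
          ring
      refine tendsto_of_tendsto_of_tendsto_of_le_of_le tendsto_const_nhds ?_
        (fun _ => zero_le) hbound
      have : Tendsto (fun k => (n k : ℝ)⁻¹ * (C ^ 2 / δ ^ 2)) atTop (𝓝 (0 * (C ^ 2 / δ ^ 2))) :=
        (tendsto_inv_atTop_zero.comp (tendsto_natCast_atTop_atTop.comp hn)).mul_const _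
      rw [zero_mul] at this
      simpa using ENNReal.tendsto_ofReal this
    have := h0.add (tendstoInProb_of_tendsto (μ := fun k => Measure.pi fun _ : Fin (n k) => Q k)
      (hlim g hg ⟨C, hC⟩))
    simpa using this

/-- The weak law of large numbers for integrable functions. -/
lemma tendstoInProb_sampleMean [IsProbabilityMeasure P] (hn : Tendsto n atTop atTop)
    (hn0 : ∀ k, 0 < n k) (hξ : ∀ k, MeasurePreserving (ξ k) (μ k) (Measure.pi fun _ => P))
    {g : X → ℝ} (hg : Measurable g) (hgint : Integrable g P) :
    TendstoInProb μ (fun k ω => sampleMean g (ξ k ω)) (∫ x, g x ∂P) := by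
  refine tendstoInProb_of_measurePreserving hξ (Y := fun k η => sampleMean g η) ?_
  have hS : AsymptoticSample P (fun k => Measure.pi fun _ : Fin (n k) => P) (fun _ η => η) :=
    asymptoticSample_of_tendsto (Q := fun _ => P) (fun _ => Measure.AbsolutelyContinuous.rfl) hn hn0
      (fun _ _ _ => tendsto_const_nhds) fun k => MeasurePreserving.id _
  set tr : ℕ → X → ℝ := fun K x => max (-(K : ℝ)) (min (g x) K) with htr
  have htr_meas : ∀ K, Measurable (tr K) := fun K =>
    measurable_const.max (hg.min measurable_const)
  have htr_bdd : ∀ K x, |tr K x| ≤ K := fun K x =>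
    abs_le.2 ⟨le_max_left _ _, max_le (by simp) (min_le_right _ _)⟩
  have htr_int : ∀ K, Integrable (tr K) P := fun K =>
    Integrable.of_bound (htr_meas K).aestronglyMeasurable K (ae_of_all _ (htr_bdd K))
  have hlim : Tendsto (fun K : ℕ => ∫ x, |g x - tr K x| ∂P) atTop (𝓝 0) := by
    have : (0 : ℝ) = ∫ _, (0 : ℝ) ∂P := by simp
    rw [this]
    refine tendsto_integral_of_dominated_convergence (fun x => |g x|) (fun K => ?_) hgint.abs
      (fun K => ae_of_all _ fun x => ?_) (ae_of_all _ fun x => ?_)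
    · exact (hg.sub (htr_meas K)).abs.aestronglyMeasurable
    · have hK : (0 : ℝ) ≤ K := by positivity
      simp only [Real.norm_eq_abs, abs_abs, htr]
      rcases le_total (g x) K with h1 | h1 <;> rcases le_total (-(K : ℝ)) (g x) with h2 | h2 <;>
        rcases abs_cases (g x) with h3 | h3 <;> grind
    · refine tendsto_const_nhds.congr' ?_
      obtain ⟨N, hN⟩ := exists_nat_ge |g x|
      filter_upwards [eventually_ge_atTop N] with K hK
      have : |g x| ≤ K := hN.trans (by exact_mod_cast hK)
      rw [abs_le] at this
      simp [htr, min_eq_left this.2, max_eq_right this.1]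
  rw [tendstoInProb_iff]
  intro δ hδ τ hτ
  have hτ2 : 0 < τ / 2 := ENNReal.half_pos hτ.ne'
  obtain ⟨K, hK, hK'⟩ := (((tendsto_order.1 hlim).2 (δ / 3) (by positivity)).and
    ((ENNReal.tendsto_nhds_zero.1 (by
      simpa using ENNReal.tendsto_ofReal (hlim.div_const (δ / 3)))) (τ / 2) hτ2)).exists
  have hdint : Integrable (fun x => |g x - tr K x|) P := (hgint.sub (htr_int K)).abs
  filter_upwards [tendstoInProb_iff.1 (hS.tendsto_of_bounded _ (htr_meas K) ⟨K, htr_bdd K⟩) (δ / 3)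
    (by positivity) _ hτ2] with k h1
  have h2 : (Measure.pi fun _ : Fin (n k) => P)
      {η | δ / 3 ≤ sampleMean (fun x => |g x - tr K x|) η} ≤ τ / 2 := by
    refine le_trans ?_ hK'
    have := mul_meas_ge_le_integral_of_nonneg (μ := Measure.pi fun _ : Fin (n k) => P)
      (f := sampleMean fun x => |g x - tr K x|)
      (ae_of_all _ fun η => sampleMean_nonneg fun j => abs_nonneg _)
      (integrable_sampleMean hdint) (δ / 3)
    rw [integral_sampleMean (hn0 k) hdint] at this
    rw [← ENNReal.ofReal_toReal (measure_ne_top (Measure.pi fun _ : Fin (n k) => P) _)]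
    apply ENNReal.ofReal_le_ofReal
    rw [le_div_iff₀ (by positivity), mul_comm]
    exact this
  refine le_trans ?_ ((add_le_add h1 h2).trans (ENNReal.add_halves τ).le)
  refine le_trans (measure_mono fun η hη => ?_) (measure_union_le _ _)
  simp only [Set.mem_union, Set.mem_ofPred_eq] at hη ⊢
  by_contra! hcon
  obtain ⟨c1, c2⟩ := hcon
  have e1 : |sampleMean g η - sampleMean (tr K) η| ≤ sampleMean (fun x => |g x - tr K x|) η := by
    rw [← sampleMean_sub]
    exact abs_sampleMean_le fun j => le_rfl
  have e2 : |∫ x, tr K x ∂P - ∫ x, g x ∂P| ≤ ∫ x, |g x - tr K x| ∂P := by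
    rw [abs_sub_comm, ← integral_sub hgint (htr_int K)]
    exact abs_integral_le_integral_abs
  have e3 : |sampleMean g η - ∫ x, g x ∂P| ≤ |sampleMean g η - sampleMean (tr K) η|
      + |sampleMean (tr K) η - ∫ x, tr K x ∂P| + |∫ x, tr K x ∂P - ∫ x, g x ∂P| := by
    refine le_trans (le_of_eq ?_) (abs_add_three _ _ _)
    congr 1; ring
  linarith

/-- **Scheffé's lemma**: convergence in probability of densities implies convergence of the
integrals of bounded functions. -/
lemma tendsto_integral_withDensity [IsProbabilityMeasure P] {D : ℕ → X → ℝ}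
    (hD : ∀ k, Measurable (D k)) (hlim : TendstoInProb (fun _ : ℕ => P) (fun k x => D k x) 1)
    (hprob : ∀ k, IsProbabilityMeasure (P.withDensity fun x => ENNReal.ofReal (D k x)))
    {g : X → ℝ} (hg : Measurable g) {C : ℝ} (hC : ∀ x, |g x| ≤ C) :
    Tendsto (fun k => ∫ x, g x ∂(P.withDensity fun x => ENNReal.ofReal (D k x))) atTop
      (𝓝 (∫ x, g x ∂P)) := by
  have hC0 : 0 ≤ C := by
    obtain ⟨x⟩ : Nonempty X := (inferInstance : (ae P).NeBot).nonempty
    exact (abs_nonneg _).trans (hC x)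
  have hpmeas : ∀ k, Measurable fun x => max (D k x) 0 := fun k => (hD k).max measurable_const
  have hlint : ∀ k, ∫⁻ x, ENNReal.ofReal (D k x) ∂P = 1 := fun k => by
    have := (hprob k).measure_univ
    rwa [withDensity_apply _ MeasurableSet.univ, Measure.restrict_univ] at this
  have hpint : ∀ k, Integrable (fun x => max (D k x) 0) P := fun k => by
    refine ⟨(hpmeas k).aestronglyMeasurable, ?_⟩
    rw [hasFiniteIntegral_iff_ofReal (f := fun x => max (D k x) 0)
      (ae_of_all _ fun x => le_max_right _ _)]
    simp [ENNReal.ofReal_max, hlint k]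
  have hp1 : ∀ k, ∫ x, max (D k x) 0 ∂P = 1 := fun k => by
    rw [integral_eq_lintegral_of_nonneg_ae (f := fun x => max (D k x) 0)
      (ae_of_all _ fun x => le_max_right _ _)
      (hpmeas k).aestronglyMeasurable]
    simp [ENNReal.ofReal_max, hlint k]
  have hgint : Integrable g P := Integrable.of_bound hg.aestronglyMeasurable C (ae_of_all _ hC)
  have hpgint : ∀ k, Integrable (fun x => max (D k x) 0 * g x) P := fun k =>
    (hpint k).mul_bdd hg.aestronglyMeasurable (ae_of_all _ hC)
  have hnegint : ∀ k, Integrable (fun x => max (1 - max (D k x) 0) 0) P := fun k =>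
    ((integrable_const 1).sub (hpint k)).pos_part
  have hneg : Tendsto (fun k => ∫ x, max (1 - max (D k x) 0) 0 ∂P) atTop (𝓝 0) := by
    rw [Metric.tendsto_nhds]
    intro δ hδ
    have h1 := (ENNReal.tendsto_toReal ENNReal.zero_ne_top).comp (hlim (δ / 2) (by positivity))
    filter_upwards [(tendsto_order.1 h1).2 (δ / 2) (by simp; positivity)] with k hk
    rw [dist_zero_right, Real.norm_eq_abs,
      abs_of_nonneg (integral_nonneg fun x => le_max_right _ _)]
    have hS : MeasurableSet {x | δ / 2 < |D k x - 1|} :=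
      measurableSet_lt measurable_const ((hD k).sub_const 1).abs
    calc ∫ x, max (1 - max (D k x) 0) 0 ∂P
        ≤ ∫ x, (δ / 2 + {x | δ / 2 < |D k x - 1|}.indicator (fun _ => (1 : ℝ)) x) ∂P := by
          refine integral_mono (hnegint k)
            ((integrable_const _).add ((integrable_const 1).indicator hS)) fun x => ?_
          by_cases hx : δ / 2 < |D k x - 1|
          · simp only [Set.indicator_of_mem (show x ∈ {x | δ / 2 < |D k x - 1|} from hx)]
            have : 0 ≤ max (D k x) 0 := le_max_right _ _
            exact max_le (by linarith) (by positivity)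
          · simp only [Set.indicator_of_notMem (show x ∉ {x | δ / 2 < |D k x - 1|} from hx)]
            rw [not_lt, abs_le] at hx
            have : D k x ≤ max (D k x) 0 := le_max_left _ _
            exact max_le (by linarith) (by positivity)
      _ = δ / 2 + P.real {x | δ / 2 < |D k x - 1|} := by
          rw [integral_add (integrable_const _) ((integrable_const 1).indicator hS),
            integral_indicator hS]
          simp
      _ < δ / 2 + δ / 2 := by gcongr; exact hk
      _ = δ := add_halves δ
  rw [tendsto_iff_dist_tendsto_zero]
  have hbound : ∀ k, dist (∫ x, g x ∂(P.withDensity fun x => ENNReal.ofReal (D k x)))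
      (∫ x, g x ∂P) ≤ 2 * C * ∫ x, max (1 - max (D k x) 0) 0 ∂P := by
    intro k
    rw [integral_withDensity_eq_integral_toReal_smul (hD k).ennreal_ofReal
      (ae_of_all _ fun x => ENNReal.ofReal_lt_top)]
    simp only [ENNReal.toReal_ofReal', smul_eq_mul]
    rw [Real.dist_eq, ← integral_sub (hpgint k) hgint]
    calc |∫ x, (max (D k x) 0 * g x - g x) ∂P|
        ≤ ∫ x, C * ((max (D k x) 0 - 1) + 2 * max (1 - max (D k x) 0) 0) ∂P := by
          refine abs_integral_le_integral_abs.trans (integral_mono ((hpgint k).sub hgint).abs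
            ((((hpint k).sub (integrable_const 1)).add ((hnegint k).const_mul 2)).const_mul C)
            fun x => ?_)
          have : max (D k x) 0 * g x - g x = g x * (max (D k x) 0 - 1) := by ring
          simp only [this, abs_mul]
          refine mul_le_mul (hC x) ?_ (abs_nonneg _) hC0
          generalize max (D k x) 0 = p
          rcases abs_cases (p - 1) with h | h <;> rcases le_total (1 - p) 0 with h' | h' <;>
            simp only [max_eq_right h', max_eq_left h'] <;> linarith
      _ = 2 * C * ∫ x, max (1 - max (D k x) 0) 0 ∂P := by
          rw [integral_const_mul, integral_add (f := fun x => max (D k x) 0 - 1)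
            ((hpint k).sub (integrable_const 1)) ((hnegint k).const_mul 2),
            integral_sub (hpint k) (integrable_const 1),
            integral_const_mul, hp1 k]
          simp only [integral_const, probReal_univ, smul_eq_mul]
          ring
  refine tendsto_of_tendsto_of_tendsto_of_le_of_le tendsto_const_nhds ?_
    (fun _ => dist_nonneg) hbound
  simpa using hneg.const_mul (2 * C)

end LawOfLargeNumbers

section Expansion

open Asymptotics

lemma isLittleO_taylor_two {f : ℝ → ℝ} (hf : ContDiffAt ℝ 2 f 1) (hf_one : f 1 = 0)
    (hf_deriv : deriv f 1 = 0) :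
    (fun t => f t - deriv (deriv f) 1 / 2 * (t - 1) ^ 2) =o[𝓝 1] fun t => (t - 1) ^ 2 := by
  have hd : DifferentiableAt ℝ (deriv f) 1 := by
    have h1 : ContDiffAt ℝ 1 (deriv f) 1 := hf.derivWithin (by norm_num)
    exact h1.differentiableAt (by norm_num)
  have hev : ∀ᶠ t in 𝓝 (1 : ℝ), DifferentiableAt ℝ f t := by
    filter_upwards [hf.eventually (by simp)] with t ht
    exact ht.differentiableAt (by norm_num)
  obtain ⟨δ, hδ, hball⟩ := Metric.eventually_nhds_iff_ball.1 hev
  have h2 := Convex.isLittleO_pow_succ_real (n := 1) (convex_ball (1 : ℝ) δ)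
    (Metric.mem_ball_self hδ)
    (f := fun t => f t - deriv (deriv f) 1 / 2 * (t - 1) ^ 2)
    (f' := fun t => deriv f t - deriv (deriv f) 1 * (t - 1)) (fun t ht => ?_) ?_
  · rw [Metric.isOpen_ball.nhdsWithin_eq (Metric.mem_ball_self hδ)] at h2
    simpa [hf_one] using h2
  · have h3 : HasDerivAt (fun t : ℝ => deriv (deriv f) 1 / 2 * (t - 1) ^ 2)
        (deriv (deriv f) 1 * (t - 1)) t := by
      refine ((((hasDerivAt_id' t).sub_const 1).fun_pow 2).const_mul
        (deriv (deriv f) 1 / 2)).congr_deriv ?_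
      simp
      ring
    exact ((hball t ht).hasDerivAt.sub h3).hasDerivWithinAt
  · rw [Metric.isOpen_ball.nhdsWithin_eq (Metric.mem_ball_self hδ)]
    have := hd.hasDerivAt.isLittleO
    simp only [hf_deriv, sub_zero, smul_eq_mul] at this
    simpa [mul_comm] using this

lemma nonneg_of_convexOn {f : ℝ → ℝ} (hf_conv : ConvexOn ℝ (Set.Ioi 0) f)
    (hf : ContDiffAt ℝ 2 f 1) (hf_one : f 1 = 0) (hf_deriv : deriv f 1 = 0)
    (hf_deriv2 : 0 < deriv (deriv f) 1) {t : ℝ} (ht : 0 < t) : 0 ≤ f t := by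
  have hloc : IsLocalMinOn f (Set.Ioi 0) 1 := by
    have := (isLittleO_taylor_two hf hf_one hf_deriv).def (half_pos hf_deriv2)
    refine Filter.Eventually.filter_mono nhdsWithin_le_nhds ?_
    filter_upwards [this] with u hu
    rw [Real.norm_eq_abs, Real.norm_eq_abs, abs_of_nonneg (sq_nonneg (u - 1)), abs_le] at hu
    rw [hf_one]
    linarith [hu.1]
  have := IsMinOn.of_isLocalMinOn_of_convexOn (Set.mem_Ioi.2 one_pos) hloc hf_conv
    (Set.mem_Ioi.2 ht)
  simpa [hf_one] using this

lemma isLittleO_fD {f : ℝ → ℝ} {ρ : ℝ} (hρ : 0 < ρ) (hf : ContDiffAt ℝ 2 f 1) (hf_one : f 1 = 0)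
    (hf_deriv : deriv f 1 = 0) :
    (fun t => fD f ρ t - deriv (deriv f) 1 / (2 * (1 + ρ)) * (t - 1) ^ 2)
      =o[𝓝 1] fun t => (t - 1) ^ 2 := by
  set c := deriv (deriv f) 1
  have hρ1 : (1 + ρ) ≠ 0 := by positivity
  have hcont : ContinuousAt (fun t : ℝ => (1 + ρ * t)⁻¹) 1 :=
    ContinuousAt.inv₀ (by fun_prop) (by simpa using hρ1)
  have h1 : (fun t => (1 + ρ * t)⁻¹ * (f t - c / 2 * (t - 1) ^ 2))
      =o[𝓝 1] fun t => 1 * (t - 1) ^ 2 :=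
    (hcont.tendsto.isBigO_one ℝ).mul_isLittleO (isLittleO_taylor_two hf hf_one hf_deriv)
  have h2 : (fun t => ((1 + ρ * t)⁻¹ - (1 + ρ * 1)⁻¹) * (c / 2 * (t - 1) ^ 2))
      =o[𝓝 1] fun t => 1 * (t - 1) ^ 2 := by
    refine IsLittleO.mul_isBigO ?_ (isBigO_const_mul_self _ _ _)
    rw [isLittleO_one_iff]
    simpa using hcont.tendsto.sub_const ((1 + ρ * 1)⁻¹)
  have h3 := h1.add h2
  simp only [one_mul] at h3
  refine h3.congr_left fun t => ?_
  simp only [fD, mul_one]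
  field_simp
  ring

variable {X : Type*} {q : ℕ} {φ : X → Vec q → ℝ}

/-- The linear map `θ ↦ betaPart θ`. -/
def betaPartL (q : ℕ) : Vec (q + 1) →L[ℝ] Vec q :=
  LinearMap.toContinuousLinearMap
    { toFun := betaPart
      map_add' := fun _ _ => rfl
      map_smul' := fun _ _ => rfl }

@[simp] lemma betaPartL_apply (θ : Vec (q + 1)) : betaPartL q θ = betaPart θ := rfl

lemma ratio_pos (x : X) (θ : Vec (q + 1)) : 0 < ratio φ x θ := Real.exp_pos _

lemma hasFDerivAt_log_ratio (hφ : ∀ x, Differentiable ℝ (φ x)) (x : X) (θ : Vec (q + 1)) :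
    HasFDerivAt (fun θ' => Real.log (ratio φ x θ'))
      (EuclideanSpace.proj 0 + (fderiv ℝ (φ x) (betaPart θ)).comp (betaPartL q)) θ := by
  simp only [ratio, Real.log_exp]
  refine HasFDerivAt.add (f := fun θ' : Vec (q + 1) => θ' 0) ?_ ?_
  · exact (EuclideanSpace.proj (𝕜 := ℝ) (0 : Fin (q + 1))).hasFDerivAt
  · exact HasFDerivAt.comp θ (hφ x (betaPart θ)).hasFDerivAt (betaPartL q).hasFDerivAt

lemma differentiable_ratio (hφ : ∀ x, Differentiable ℝ (φ x)) (x : X) :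
    Differentiable ℝ (ratio φ x) := fun θ => by
  have := (hasFDerivAt_log_ratio hφ x θ).exp
  simp only [Real.exp_log (ratio_pos x _)] at this
  exact this.differentiableAt

lemma gradRatio_eq (hφ : ∀ x, Differentiable ℝ (φ x)) (x : X) (θ : Vec (q + 1)) :
    gradRatio φ x θ = ratio φ x θ • gradLogRatio φ x θ := by
  have h := (hasFDerivAt_log_ratio hφ x θ)
  have h1 := h.exp
  simp only [Real.exp_log (ratio_pos x _)] at h1
  rw [gradRatio, gradLogRatio, gradient, gradient, h1.fderiv, h.fderiv, map_smul]

lemma gradLogRatio_inner (hφ : ∀ x, Differentiable ℝ (φ x)) (x : X) (θ v : Vec (q + 1)) :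
    inner ℝ (gradLogRatio φ x θ) v
      = v 0 + inner ℝ (gradient (φ x) (betaPart θ)) (betaPart v) := by
  rw [gradLogRatio, inner_gradient_left, inner_gradient_left,
    (hasFDerivAt_log_ratio hφ x θ).fderiv]
  simp

lemma gradLogRatio_zero (hφ : ∀ x, Differentiable ℝ (φ x)) (x : X) (θ : Vec (q + 1)) :
    gradLogRatio φ x θ 0 = 1 := by
  have := gradLogRatio_inner hφ x θ (EuclideanSpace.single 0 1)
  rw [EuclideanSpace.inner_single_right] at this
  simp only [one_mul, conj_trivial, PiLp.single_apply] at this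
  rw [this, show betaPart (EuclideanSpace.single (0 : Fin (q + 1)) (1 : ℝ)) = 0 by
    ext i; simp [betaPart]]
  simp

lemma gradLogRatio_succ (hφ : ∀ x, Differentiable ℝ (φ x)) (x : X) (θ : Vec (q + 1)) (i : Fin q) :
    gradLogRatio φ x θ i.succ = gradient (φ x) (betaPart θ) i := by
  have := gradLogRatio_inner hφ x θ (EuclideanSpace.single i.succ 1)
  rw [EuclideanSpace.inner_single_right, show betaPart (EuclideanSpace.single i.succ (1 : ℝ))
    = EuclideanSpace.single i 1 by ext j; simp [betaPart],
    EuclideanSpace.inner_single_right] at this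
  simpa [Fin.succ_ne_zero, eq_comm] using this

/-- Second-order expansion of `f_d (r (x; θ))` at `θ*`. -/
lemma isLittleO_fD_ratio {f : ℝ → ℝ} {ρ : ℝ} (hρ : 0 < ρ) (hf : ContDiffAt ℝ 2 f 1)
    (hf_one : f 1 = 0) (hf_deriv : deriv f 1 = 0) (hφ : ∀ x, Differentiable ℝ (φ x))
    {θstar : Vec (q + 1)} (x : X) (hstar : ratio φ x θstar = 1) :
    (fun t => fD f ρ (ratio φ x (θstar + t))
      - deriv (deriv f) 1 / (2 * (1 + ρ)) * inner ℝ (gradRatio φ x θstar) t ^ 2)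
      =o[𝓝 0] fun t : Vec (q + 1) => ‖t‖ ^ 2 := by
  set κ := deriv (deriv f) 1 / (2 * (1 + ρ))
  have hgrad : (fun t => ratio φ x (θstar + t) - 1 - inner ℝ (gradRatio φ x θstar) t)
      =o[𝓝 0] fun t : Vec (q + 1) => t := by
    have := hasGradientAt_iff_isLittleO_nhds_zero.1 (differentiable_ratio hφ x θstar).hasGradientAt
    rw [hstar] at this
    exact this
  have hO : (fun t => ratio φ x (θstar + t) - 1) =O[𝓝 0] fun t : Vec (q + 1) => t := by
    have h1 : (fun t : Vec (q + 1) => inner ℝ (gradRatio φ x θstar) t) =O[𝓝 0] fun t => t :=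
      (innerSL ℝ (gradRatio φ x θstar)).isBigO_id _
    refine (hgrad.isBigO.add h1).congr_left fun t => ?_
    ring
  have hO' : (fun t : Vec (q + 1) => inner ℝ (gradRatio φ x θstar) t) =O[𝓝 0] fun t => t :=
    (innerSL ℝ (gradRatio φ x θstar)).isBigO_id _
  have htend : Tendsto (fun t : Vec (q + 1) => ratio φ x (θstar + t)) (𝓝 0) (𝓝 1) := by
    have : ContinuousAt (fun t : Vec (q + 1) => ratio φ x (θstar + t)) 0 :=
      ((differentiable_ratio hφ x).continuous.comp
        (continuous_const.add continuous_id)).continuousAt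
    simpa [ContinuousAt, hstar] using this
  have h1 : (fun t => fD f ρ (ratio φ x (θstar + t)) - κ * (ratio φ x (θstar + t) - 1) ^ 2)
      =o[𝓝 0] fun t : Vec (q + 1) => ‖t‖ ^ 2 :=
    ((isLittleO_fD hρ hf hf_one hf_deriv).comp_tendsto htend).trans_isBigO (hO.norm_right.pow 2)
  have h2 : (fun t => κ * ((ratio φ x (θstar + t) - 1 - inner ℝ (gradRatio φ x θstar) t)
      * (ratio φ x (θstar + t) - 1 + inner ℝ (gradRatio φ x θstar) t)))
      =o[𝓝 0] fun t : Vec (q + 1) => ‖t‖ ^ 2 := by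
    have := (hgrad.norm_right.mul_isBigO (hO.add hO').norm_right).const_mul_left κ
    simpa [sq] using this
  refine (h1.add h2).congr_left fun t => ?_
  ring

lemma continuous_fD_exp {f : ℝ → ℝ} (hf : ConvexOn ℝ (Set.Ioi 0) f) {ρ : ℝ} (hρ : 0 < ρ) :
    Continuous fun u => fD f ρ (Real.exp u) := by
  refine Continuous.div ?_ (by fun_prop) fun u => by positivity
  exact (hf.continuousOn isOpen_Ioi).comp_continuous Real.continuous_exp fun u => Real.exp_pos u

lemma continuous_fD_ratio {f : ℝ → ℝ} (hf : ConvexOn ℝ (Set.Ioi 0) f) {ρ : ℝ} (hρ : 0 < ρ)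
    (hφ : ∀ x, Differentiable ℝ (φ x)) (x : X) : Continuous fun θ => fD f ρ (ratio φ x θ) := by
  have : Continuous fun θ : Vec (q + 1) => θ 0 + φ x (betaPart θ) :=
    Continuous.add (by fun_prop) ((hφ x).continuous.comp (betaPartL q).continuous)
  exact (continuous_fD_exp hf hρ).comp this

lemma gradRatio_eq_gradLogRatio (hφ_diff : ∀ x, Differentiable ℝ (φ x))
    {θstar : Vec (q + 1)} (hstar : ∀ x, ratio φ x θstar = 1) (x : X) :
    gradRatio φ x θstar = gradLogRatio φ x θstar := by
  rw [gradRatio_eq hφ_diff, hstar, one_smul]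

end Expansion

section Envelope

variable {X V : Type*} [MeasurableSpace X] [NormedAddCommGroup V]
  [TopologicalSpace.SeparableSpace V]

/-- A measurable smallest constant in the bounds `|R x t| ≤ w ‖t‖²` on balls. -/
lemma exists_envelope {R : X → V → ℝ} (hR : ∀ t, Measurable fun x => R x t)
    (hRc : ∀ x, Continuous (R x)) (hR0 : ∀ x, R x 0 = 0) :
    ∃ w : ℕ → X → ℝ, (∀ n, Measurable (w n)) ∧ (∀ n x, 0 ≤ w n x) ∧
      ∀ (n : ℕ) x b, 0 ≤ b → (∀ t, ‖t‖ < 1 / ((n : ℝ) + 1) → |R x t| ≤ b * ‖t‖ ^ 2) →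
        w n x ≤ b ∧ ∀ t, ‖t‖ < 1 / ((n : ℝ) + 1) → |R x t| ≤ w n x * ‖t‖ ^ 2 := by
  classical
  set d := TopologicalSpace.denseSeq V
  set F : ℕ → X → ENNReal := fun n x => ⨆ i : ℕ,
    if d i ≠ 0 ∧ ‖d i‖ < 1 / ((n : ℝ) + 1) then ENNReal.ofReal (|R x (d i)| / ‖d i‖ ^ 2) else 0
  refine ⟨fun n x => (F n x).toReal, fun n => ?_, fun n x => ENNReal.toReal_nonneg,
    fun n x b hb h => ?_⟩
  · refine (Measurable.iSup fun i => ?_).ennreal_toReal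
    split_ifs
    · exact ((hR _).abs.div_const _).ennreal_ofReal
    · exact measurable_const
  · have hle : F n x ≤ ENNReal.ofReal b := by
      refine iSup_le fun i => ?_
      split_ifs with hi
      · refine ENNReal.ofReal_le_ofReal ?_
        have : 0 < ‖d i‖ ^ 2 := pow_pos (norm_pos_iff.2 hi.1) 2
        rw [div_le_iff₀ this]
        exact h _ hi.2
      · exact zero_le
    have hne : F n x ≠ ⊤ := ne_top_of_le_ne_top ENNReal.ofReal_ne_top hle
    refine ⟨ENNReal.toReal_le_of_le_ofReal hb hle, fun t ht => ?_⟩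
    rcases eq_or_ne t 0 with rfl | ht0
    · simp [hR0]
    by_contra! hcon
    have hopen : IsOpen {u : V | u ≠ 0 ∧ ‖u‖ < 1 / ((n : ℝ) + 1)
        ∧ (F n x).toReal * ‖u‖ ^ 2 < |R x u|} :=
      isOpen_ne.inter ((isOpen_lt continuous_norm continuous_const).inter
        (isOpen_lt (continuous_const.mul (continuous_norm.pow 2)) (hRc x).abs))
    obtain ⟨i, hi0, hi1, hi2⟩ :=
      (TopologicalSpace.denseRange_denseSeq V).exists_mem_open hopen ⟨t, ht0, ht, hcon⟩
    have hpos : 0 < ‖d i‖ ^ 2 := pow_pos (norm_pos_iff.2 hi0) 2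
    have h1 : ENNReal.ofReal (|R x (d i)| / ‖d i‖ ^ 2) ≤ F n x := by
      have := le_iSup (fun i : ℕ => if d i ≠ 0 ∧ ‖d i‖ < 1 / ((n : ℝ) + 1) then
        ENNReal.ofReal (|R x (d i)| / ‖d i‖ ^ 2) else 0) i
      rwa [if_pos ⟨hi0, hi1⟩] at this
    have h2 := ENNReal.ofReal_le_iff_le_toReal hne |>.1 h1
    rw [div_le_iff₀ hpos] at h2
    exact absurd hi2 (not_lt.2 h2)

/-- The quadratic form of a matrix. -/
def quadForm {n : ℕ} (A : Matrix (Fin n) (Fin n) ℝ) (y : Vec n) : ℝ := y.ofLp ⬝ᵥ A.mulVec y.ofLp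

lemma quadForm_eq_sum {n : ℕ} (A : Matrix (Fin n) (Fin n) ℝ) (y : Vec n) :
    quadForm A y = ∑ i, ∑ j, A i j * (y i * y j) := by
  simp only [quadForm, dotProduct, Matrix.mulVec, Finset.mul_sum]
  exact Finset.sum_congr rfl fun i _ => Finset.sum_congr rfl fun j _ => by ring

end Envelope

section QuadraticApproximation

variable {X : Type*} [MeasurableSpace X] {P : Measure X} [IsProbabilityMeasure P]
  {Ω : ℕ → Type*} [∀ k, MeasurableSpace (Ω k)] {μ : ∀ k, Measure (Ω k)}
  {n : ℕ → ℕ} {ξ : ∀ k, Ω k → Fin (n k) → X} {d : ℕ}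

lemma abs_apply_le_norm (y : Vec d) (i : Fin d) : |y i| ≤ ‖y‖ := by
  simpa using PiLp.norm_apply_le y i

lemma boundedInProb_apply_mul {Y : ∀ k, Ω k → Vec d} (hY : BoundedInProb μ fun k ω => ‖Y k ω‖)
    (i j : Fin d) : BoundedInProb μ fun k ω => Y k ω i * Y k ω j := by
  refine hY.mul_self.of_abs_le zero_le_one le_rfl (Eventually.of_forall fun k ω => ?_)
  rw [one_mul, add_zero, abs_mul, abs_pow, abs_norm, sq]
  exact mul_le_mul (abs_apply_le_norm _ _) (abs_apply_le_norm _ _) (abs_nonneg _) (norm_nonneg _)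

/-- Quadratic forms with consistently estimated coefficients. -/
lemma tendstoInProb_sum_quadratic {A : Matrix (Fin d) (Fin d) ℝ}
    {Ahat : ∀ k, Ω k → Matrix (Fin d) (Fin d) ℝ}
    (hA : ∀ i j, TendstoInProb μ (fun k ω => Ahat k ω i j) (A i j))
    {Y : ∀ k, Ω k → Vec d} (hY : BoundedInProb μ fun k ω => ‖Y k ω‖) :
    TendstoInProb μ (fun k ω => quadForm (Ahat k ω) (Y k ω) - quadForm A (Y k ω)) 0 := by
  have h : TendstoInProb μ
      (fun k ω => ∑ i, ∑ j, (Ahat k ω i j - A i j) * (Y k ω i * Y k ω j)) 0 := by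
    have h1 : ∀ i j, TendstoInProb μ (fun k ω => (Ahat k ω i j - A i j) * (Y k ω i * Y k ω j)) 0 :=
      fun i j => (hA i j).sub_const.mul_bounded (boundedInProb_apply_mul hY i j)
    have h2 := TendstoInProb.sum Finset.univ fun i _ =>
      TendstoInProb.sum Finset.univ fun j _ => h1 i j
    simpa using h2
  refine h.congr fun k => ae_of_all _ fun ω => ?_
  simp only [quadForm_eq_sum, sub_mul, Finset.sum_sub_distrib]

/-- Sample averages of functions with a second-order expansion with integrable remainder. -/
lemma tendstoInProb_sampleMean_quadratic (hS : AsymptoticSample P μ ξ)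
    {g : X → Vec d → ℝ} {v : X → Vec d} {κ : ℝ} {B : X → ℝ}
    (hg : ∀ t, Measurable fun x => g x t) (hv : Measurable v)
    (hgc : ∀ x, Continuous (g x)) (hg0 : ∀ x, g x 0 = 0)
    (hexp : ∀ x, (fun t => g x t - κ * inner ℝ (v x) t ^ 2) =o[𝓝 0] fun t => ‖t‖ ^ 2)
    (hB : Measurable B) (hBint : Integrable B P) {δ₀ : ℝ} (hδ₀ : 0 < δ₀)
    (hdom : ∀ᵐ x ∂P, 0 ≤ B x ∧ ∀ t, ‖t‖ < δ₀ → |g x t - κ * inner ℝ (v x) t ^ 2| ≤ B x * ‖t‖ ^ 2)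
    (hBlln : TendstoInProb μ (fun k ω => sampleMean B (ξ k ω)) (∫ x, B x ∂P))
    {M : Matrix (Fin d) (Fin d) ℝ}
    (hM : ∀ i j, TendstoInProb μ (fun k ω => sampleMean (fun x => v x i * v x j) (ξ k ω)) (M i j))
    {m : ℕ → ℝ} (hm0 : ∀ k, 0 < m k) (hm : Tendsto m atTop atTop)
    {Y : ∀ k, Ω k → Vec d} (hY : BoundedInProb μ fun k ω => ‖Y k ω‖) :
    TendstoInProb μ (fun k ω => m k * sampleMean (fun x => g x ((√(m k))⁻¹ • Y k ω)) (ξ k ω)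
      - κ * quadForm M (Y k ω)) 0 := by
  set R : X → Vec d → ℝ := fun x t => g x t - κ * inner ℝ (v x) t ^ 2 with hRdef
  obtain ⟨w, hw, hw0, hwR⟩ := exists_envelope (R := R)
    (fun t => (hg t).sub (((hv.inner measurable_const).pow_const 2).const_mul κ))
    (fun x => (hgc x).sub (((continuous_const.inner continuous_id).pow 2).const_mul κ))
    (fun x => by simp [hRdef, hg0])
  obtain ⟨n₀, hn₀⟩ := exists_nat_one_div_lt hδ₀
  have hlt : ∀ N : ℕ, n₀ ≤ N → 1 / ((N : ℝ) + 1) ≤ δ₀ := fun N hN =>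
    (Nat.one_div_le_one_div hN).trans hn₀.le
  have hdomN : ∀ N : ℕ, n₀ ≤ N → ∀ᵐ x ∂P, w N x ≤ B x ∧
      ∀ t, ‖t‖ < 1 / ((N : ℝ) + 1) → |R x t| ≤ w N x * ‖t‖ ^ 2 := fun N hN => by
    filter_upwards [hdom] with x hx
    exact hwR N x (B x) hx.1 fun t ht => hx.2 t (ht.trans_le (hlt N hN))
  have hwlim : Tendsto (fun N => ∫ x, w (N + n₀) x ∂P) atTop (𝓝 0) := by
    have : (0 : ℝ) = ∫ _, (0 : ℝ) ∂P := by simp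
    rw [this]
    refine tendsto_integral_of_dominated_convergence B (fun N => (hw _).aestronglyMeasurable) hBint
      (fun N => ?_) (ae_of_all _ fun x => ?_)
    · filter_upwards [hdomN (N + n₀) (by omega)] with x hx
      rw [Real.norm_eq_abs, abs_of_nonneg (hw0 _ x)]
      exact hx.1
    · rw [tendsto_add_atTop_iff_nat (f := fun N => w N x) n₀, Metric.tendsto_atTop]
      intro τ hτ
      have h1 := (hexp x).def (half_pos hτ)
      obtain ⟨η, hη, hball⟩ := Metric.eventually_nhds_iff.1 h1
      obtain ⟨N, hN⟩ := exists_nat_one_div_lt hη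
      refine ⟨N, fun N' hN' => ?_⟩
      have h2 := (hwR N' x (τ / 2) (by positivity) fun t ht => ?_).1
      · rw [Real.dist_eq, sub_zero, abs_of_nonneg (hw0 _ x)]
        linarith
      · have h3 : dist t 0 < η := by
          rw [dist_zero_right]
          exact ht.trans_le ((Nat.one_div_le_one_div hN').trans hN.le)
        simpa using hball h3
  have hquad : TendstoInProb μ (fun k ω => κ * (quadForm
      (Matrix.of fun i j => sampleMean (fun x => v x i * v x j) (ξ k ω)) (Y k ω)
        - quadForm M (Y k ω))) 0 := by
    have := (tendstoInProb_sum_quadratic (A := M) (Ahat := fun k ω =>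
      Matrix.of fun i j => sampleMean (fun x => v x i * v x j) (ξ k ω)) hM hY).const_mul κ
    simpa using this
  have hrem : TendstoInProb μ
      (fun k ω => m k * sampleMean (fun x => R x ((√(m k))⁻¹ • Y k ω)) (ξ k ω)) 0 := by
    rw [tendstoInProb_iff]
    intro δ hδ τ hτ
    have hτ2 : 0 < τ / 2 := ENNReal.half_pos hτ.ne'
    obtain ⟨K, hK, hYK⟩ := hY (τ / 2) hτ2
    obtain ⟨N₁, hN₁⟩ := ((tendsto_order.1 hwlim).2 (δ / (2 * K ^ 2)) (by positivity)).exists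
    set N := N₁ + n₀
    have hwlln := hS.tendsto_of_dominated (hw N) hB hBint hBlln (by
      filter_upwards [hdomN N (by omega)] with x hx using ⟨hw0 _ x, hx.1⟩)
    have hsm : ∀ᶠ k in atTop, K / √(m k) < 1 / ((N : ℝ) + 1) := by
      have : Tendsto (fun k => K / √(m k)) atTop (𝓝 0) :=
        tendsto_const_nhds.div_atTop (Real.tendsto_sqrt_atTop.comp hm)
      exact (tendsto_order.1 this).2 _ Nat.one_div_pos_of_nat
    filter_upwards [hYK, hsm, tendstoInProb_iff.1 hwlln (δ / (2 * K ^ 2)) (by positivity) _ hτ2]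
      with k h1 h2 h3
    refine le_trans ?_ ((add_le_add h1 h3).trans (ENNReal.add_halves τ).le)
    refine le_trans (measure_mono_ae ?_) (measure_union_le _ _)
    filter_upwards [hS.ae_forall _ (hdomN N (by omega)) k] with ω hω hω'
    change δ < |m k * sampleMean (fun x => R x ((√(m k))⁻¹ • Y k ω)) (ξ k ω) - 0| at hω'
    by_contra hcon
    have hcon' := not_or.1 hcon
    simp only [Set.mem_ofPred_eq, not_lt, abs_norm] at hcon'
    obtain ⟨c1, c2⟩ := hcon'
    have hsq : 0 < √(m k) := Real.sqrt_pos.2 (hm0 k)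
    have hnorm : ‖(√(m k))⁻¹ • Y k ω‖ = ‖Y k ω‖ / √(m k) := by
      rw [norm_smul, norm_inv, Real.norm_eq_abs, abs_of_pos hsq, div_eq_inv_mul]
    have hsmall : ‖(√(m k))⁻¹ • Y k ω‖ < 1 / ((N : ℝ) + 1) := by
      rw [hnorm]
      exact lt_of_le_of_lt (by gcongr) h2
    have e1 : |sampleMean (fun x => R x ((√(m k))⁻¹ • Y k ω)) (ξ k ω)|
        ≤ ‖(√(m k))⁻¹ • Y k ω‖ ^ 2 * sampleMean (w N) (ξ k ω) := by
      rw [← sampleMean_const_mul]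
      refine abs_sampleMean_le fun j => ?_
      rw [mul_comm]
      exact (hω j).2 _ hsmall
    have e2 : sampleMean (w N) (ξ k ω) < δ / K ^ 2 := by
      have h4 : δ / (2 * K ^ 2) + δ / (2 * K ^ 2) = δ / K ^ 2 := by field_simp; ring
      linarith [(abs_le.1 c2).2]
    have e3 : m k * ‖(√(m k))⁻¹ • Y k ω‖ ^ 2 = ‖Y k ω‖ ^ 2 := by
      rw [hnorm, div_pow, Real.sq_sqrt (hm0 k).le, mul_div_cancel₀ _ (hm0 k).ne']
    rw [sub_zero, abs_mul, abs_of_pos (hm0 k)] at hω'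
    have e4 : m k * |sampleMean (fun x => R x ((√(m k))⁻¹ • Y k ω)) (ξ k ω)|
        ≤ ‖Y k ω‖ ^ 2 * sampleMean (w N) (ξ k ω) := by
      rw [← e3, mul_assoc]
      exact mul_le_mul_of_nonneg_left e1 (hm0 k).le
    have e5 : ‖Y k ω‖ ^ 2 * sampleMean (w N) (ξ k ω) ≤ K ^ 2 * (δ / K ^ 2) :=
      mul_le_mul (pow_le_pow_left₀ (norm_nonneg _) c1 2) e2.le
        (sampleMean_nonneg fun j => hw0 _ _) (by positivity)
    rw [mul_div_cancel₀ _ (by positivity)] at e5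
    linarith
  have := hquad.add hrem
  rw [add_zero] at this
  refine this.congr fun k => ae_of_all _ fun ω => ?_
  have hsq : 0 < √(m k) := Real.sqrt_pos.2 (hm0 k)
  have e1 : sampleMean (fun x => R x ((√(m k))⁻¹ • Y k ω)) (ξ k ω)
      = sampleMean (fun x => g x ((√(m k))⁻¹ • Y k ω)) (ξ k ω)
        - κ * ((m k)⁻¹ * quadForm
          (Matrix.of fun i j => sampleMean (fun x => v x i * v x j) (ξ k ω)) (Y k ω)) := by
    rw [hRdef, sampleMean_sub, sampleMean_const_mul]
    congr 2
    rw [quadForm_eq_sum]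
    have e2 : ∀ x, inner ℝ (v x) ((√(m k))⁻¹ • Y k ω) ^ 2
        = (m k)⁻¹ * ∑ i, ∑ j, (Y k ω i * Y k ω j) * (v x i * v x j) := fun x => by
      rw [inner_smul_right, mul_pow, inv_pow, Real.sq_sqrt (hm0 k).le, PiLp.inner_apply, sq,
        Finset.sum_mul_sum]
      congr 1
      refine Finset.sum_congr rfl fun i _ => Finset.sum_congr rfl fun j _ => ?_
      simp only [RCLike.inner_apply, conj_trivial]
      ring
    simp only [e2, sampleMean_const_mul, sampleMean_sum, Matrix.of_apply]
    congr 1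
    refine Finset.sum_congr rfl fun i _ => Finset.sum_congr rfl fun j _ => ?_
    ring
  rw [e1]
  have := (hm0 k).ne'
  field_simp
  ring

end QuadraticApproximation

section Atoms

open Matrix
open scoped MatrixOrder

lemma continuous_quadForm {n : ℕ} (A : Matrix (Fin n) (Fin n) ℝ) : Continuous (quadForm A) := by
  have : quadForm A = fun y => ∑ i, ∑ j, A i j * (y i * y j) := funext (quadForm_eq_sum A)
  rw [this]
  fun_prop

lemma quadForm_smul_add {n : ℕ} (A : Matrix (Fin n) (Fin n) ℝ) (t : ℝ) (u w : Vec n) :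
    quadForm A (t • u + w) = quadForm A u * t ^ 2
      + (u.ofLp ⬝ᵥ A *ᵥ w.ofLp + w.ofLp ⬝ᵥ A *ᵥ u.ofLp) * t + quadForm A w := by
  simp only [quadForm, WithLp.ofLp_add, WithLp.ofLp_smul, mulVec_add, mulVec_smul, add_dotProduct,
    dotProduct_add, smul_dotProduct, dotProduct_smul, smul_eq_mul]
  ring

lemma finite_setOf_quadratic {a b c d : ℝ} (ha : a ≠ 0) :
    {t : ℝ | a * t ^ 2 + b * t + c = d}.Finite := by
  open Polynomial in
  have hp : (C a * X ^ 2 + C b * X + C (c - d) : ℝ[X]) ≠ 0 := by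
    intro h0
    have := congrArg (fun p => p.coeff 2) h0
    simp [ha] at this
  refine (Polynomial.finite_setOfPred_isRoot hp).subset fun t ht => ?_
  change a * t ^ 2 + b * t + c = d at ht
  simp only [Polynomial.IsRoot, Set.mem_ofPred_eq, Polynomial.eval_add, Polynomial.eval_mul,
    Polynomial.eval_C, Polynomial.eval_pow, Polynomial.eval_X]
  linarith

/-- A quadratic polynomial of a standard Gaussian vector has no atoms if it has degree two along
some coordinate axis. -/
lemma stdGaussian_quadForm_eq_zero {q n : ℕ} (A : Matrix (Fin n) (Fin n) ℝ)
    (L : Vec (q + 1) →L[ℝ] Vec n) (h : Vec n) (i : Fin (q + 1))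
    (hi : quadForm A (L (EuclideanSpace.single i 1)) ≠ 0) (c : ℝ) :
    stdGaussian (Vec (q + 1)) {z | quadForm A (L z + h) = c} = 0 := by
  have hF : Continuous fun z : Vec (q + 1) => quadForm A (L z + h) :=
    (continuous_quadForm A).comp (L.continuous.add continuous_const)
  have hS : MeasurableSet {z : Vec (q + 1) | quadForm A (L z + h) = c} :=
    (isClosed_eq hF continuous_const).measurableSet
  rw [← map_pi_eq_stdGaussian, Measure.map_apply (by fun_prop) hS]
  set S : Set (Fin (q + 1) → ℝ) := WithLp.toLp 2 ⁻¹' {z : Vec (q + 1) | quadForm A (L z + h) = c}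
  have hSm : MeasurableSet S := hS.preimage (by fun_prop)
  have hmp := (measurePreserving_piFinSuccAbove (fun _ : Fin (q + 1) => gaussianReal 0 1) i).symm
  rw [← hmp.measure_preimage hSm.nullMeasurableSet,
    Measure.prod_apply_symm (hSm.preimage (MeasurableEquiv.measurable _))]
  rw [lintegral_eq_zero_iff' (by
    exact (measurable_measure_prodMk_right
      (hSm.preimage (MeasurableEquiv.measurable _))).aemeasurable)]
  refine ae_of_all _ fun y => ?_
  have hno : NullSingletonClass (gaussianReal 0 1) := nullSingletonClass_gaussianReal (by norm_num)
  refine Set.Finite.measure_zero ?_ _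
  refine (finite_setOf_quadratic (a := quadForm A (L (EuclideanSpace.single i 1)))
    (b := (L (EuclideanSpace.single i 1)).ofLp ⬝ᵥ
        A *ᵥ (L (WithLp.toLp 2 (i.insertNth 0 y)) + h).ofLp
      + (L (WithLp.toLp 2 (i.insertNth 0 y)) + h).ofLp ⬝ᵥ
        A *ᵥ (L (EuclideanSpace.single i 1)).ofLp)
    (c := quadForm A (L (WithLp.toLp 2 (i.insertNth 0 y)) + h)) (d := c) hi).subset fun t ht => ?_
  change quadForm A (L (WithLp.toLp 2 (i.insertNth t y)) + h) = c at ht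
  rw [Set.mem_ofPred_eq, ← quadForm_smul_add, ← ht, ← add_assoc, ← map_smul, ← map_add]
  congr 3
  ext j
  refine Fin.succAboveCases i ?_ (fun j => ?_) j
  · simp
  · simp [Fin.succAbove_ne]

/-- The covariance matrix is positive semidefinite. -/
lemma posSemidef_covMat {X : Type*} [MeasurableSpace X] {P : Measure X} [IsProbabilityMeasure P]
    {n : ℕ} {g : X → Vec n} (hg : ∀ i, MemLp (fun x => g x i) 2 P) : (covMat P g).PosSemidef := by
  refine PosSemidef.of_dotProduct_mulVec_nonneg ?_ fun v => ?_
  · ext i j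
    simp [covMat, covariance_comm]
  · have h1 : ∀ i, MemLp (fun x => v i * g x i) 2 P := fun i => (hg i).const_mul _
    have h2 := variance_fun_sum' (s := Finset.univ) fun i _ => h1 i
    have h3 := variance_nonneg (fun x => ∑ i, v i * g x i) P
    rw [h2] at h3
    refine h3.trans (le_of_eq ?_)
    simp only [dotProduct, mulVec, Finset.mul_sum, covMat, of_apply, covariance_const_mul_left,
      covariance_const_mul_right, Pi.star_apply, star_trivial]
    exact Finset.sum_congr rfl fun i _ => Finset.sum_congr rfl fun j _ => by ring

/-- The second moment matrix is the sum of the covariance matrix and the square of the mean. -/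
lemma matM_eq_covMat_add {X : Type*} [MeasurableSpace X] {P : Measure X} [IsProbabilityMeasure P]
    {q : ℕ} {φ : X → Vec q → ℝ} {θ : Vec (q + 1)}
    (hg : ∀ i, MemLp (fun x => gradLogRatio φ x θ i) 2 P) :
    matM P φ θ = covMat P (fun x => gradLogRatio φ x θ)
      + vecMulVec (fun i => ∫ x, gradLogRatio φ x θ i ∂P)
        (fun i => ∫ x, gradLogRatio φ x θ i ∂P) := by
  ext i j
  simp only [matM, covMat, of_apply, Matrix.add_apply, vecMulVec_apply]
  rw [covariance_eq_sub (hg i) (hg j)]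
  simp

lemma quadForm_nonneg {n : ℕ} {C : Matrix (Fin n) (Fin n) ℝ} (hC : C.PosSemidef) (y : Vec n) :
    0 ≤ quadForm C y := by
  simpa [quadForm] using hC.dotProduct_mulVec_nonneg y.ofLp

lemma quadForm_add_vecMulVec {n : ℕ} (C : Matrix (Fin n) (Fin n) ℝ) (u : Fin n → ℝ) (y : Vec n) :
    quadForm (C + vecMulVec u u) y = quadForm C y + (u ⬝ᵥ y.ofLp) ^ 2 := by
  simp only [quadForm, add_mulVec, dotProduct_add, vecMulVec_mulVec]
  simp [sq, dotProduct_comm y.ofLp u]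

/-- If `M = C + u uᵀ` is nondegenerate of size at least two, with `C` positive semidefinite, then
`y ↦ yᵀ C y` does not vanish on the range of `M⁻¹ C^{1/2}`. -/
lemma exists_quadForm_pos {q : ℕ} (hq : 1 ≤ q) {C M U R : Matrix (Fin (q + 1)) (Fin (q + 1)) ℝ}
    (hC : C.PosSemidef) {u : Fin (q + 1) → ℝ} (hM : M = C + vecMulVec u u) (hMdet : M.det ≠ 0)
    {t s : ℝ} (ht : t ≠ 0) (hs : s ≠ 0) (hU : U = t • M) (hR : R * R = s • C) :
    ∃ i, 0 < quadForm C (WithLp.toLp 2 ((U⁻¹ * R) *ᵥ Pi.single i 1)) := by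
  by_contra! hcon
  have hUdet : IsUnit U.det := by
    rw [hU, det_smul]
    exact isUnit_iff_ne_zero.2 (mul_ne_zero (pow_ne_zero _ ht) hMdet)
  have h1 : C * (U⁻¹ * R) = 0 := by
    refine ext_of_mulVec_single fun i => ?_
    have h0 := le_antisymm (hcon i) (quadForm_nonneg hC _)
    have := (hC.dotProduct_mulVec_zero_iff ((U⁻¹ * R) *ᵥ Pi.single i 1)).1
      (by simpa [quadForm] using h0)
    rw [← mulVec_mulVec, this, zero_mulVec]
  have h2 : C * (U⁻¹ * C) = 0 := by
    have : s • (C * (U⁻¹ * C)) = 0 := by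
      rw [← Matrix.mul_smul, ← Matrix.mul_smul, ← hR, ← Matrix.mul_assoc, ← Matrix.mul_assoc,
        Matrix.mul_assoc C, h1, Matrix.zero_mul]
    exact (smul_eq_zero.1 this).resolve_left hs
  have hMpsd : M.PosSemidef := by
    rw [hM]
    exact hC.add (by simpa using posSemidef_vecMulVec_self_star u)
  have h3 : C = 0 := by
    refine ext_of_mulVec_single fun i => ?_
    set v : Fin (q + 1) → ℝ := Pi.single i 1
    set z := U⁻¹ *ᵥ (C *ᵥ v) with hz
    have hUz : U *ᵥ z = C *ᵥ v := by
      rw [hz, mulVec_mulVec, mul_nonsing_inv _ hUdet, one_mulVec]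
    have h4 : z ⬝ᵥ (C *ᵥ v) = 0 := by
      have h5 : C *ᵥ z = 0 := by
        rw [hz, mulVec_mulVec, mulVec_mulVec, Matrix.mul_assoc, h2, zero_mulVec]
      have hsym : Cᵀ = C := by simpa [IsHermitian] using hC.isHermitian
      rw [dotProduct_mulVec, ← hsym, vecMul_transpose, h5, zero_dotProduct]
    rw [← hUz, hU, smul_mulVec, dotProduct_smul, smul_eq_zero] at h4
    have h6 := (hMpsd.dotProduct_mulVec_zero_iff z).1 (by simpa using h4.resolve_left ht)
    rw [← hUz, hU, smul_mulVec, h6, smul_zero, zero_mulVec]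
  have : Nontrivial (Fin (q + 1)) := Fin.nontrivial_iff_two_le.2 (by omega)
  rw [hM, h3, zero_add, det_vecMulVec] at hMdet
  exact hMdet rfl

/-- A quadratic polynomial of a Gaussian vector has no atoms if it is not degenerate. -/
lemma multivariateGaussian_quadForm_eq_zero {q : ℕ} {A C U : Matrix (Fin (q + 1)) (Fin (q + 1)) ℝ}
    (h : Vec (q + 1)) {i : Fin (q + 1)}
    (hi : 0 < quadForm A (WithLp.toLp 2 ((U⁻¹ * CFC.sqrt C) *ᵥ Pi.single i 1))) (c : ℝ) :
    multivariateGaussian (0 : Vec (q + 1)) C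
      {w | quadForm A (WithLp.toLp 2 (U⁻¹ *ᵥ w.ofLp) + h) = c} = 0 := by
  have hF : Continuous fun w : Vec (q + 1) => quadForm A (WithLp.toLp 2 (U⁻¹ *ᵥ w.ofLp) + h) := by
    refine (continuous_quadForm A).comp (Continuous.add ?_ continuous_const)
    exact (toEuclideanCLM (𝕜 := ℝ) U⁻¹).continuous
  rw [multivariateGaussian, Measure.map_apply (by fun_prop)
    (isClosed_eq hF continuous_const).measurableSet]
  have := stdGaussian_quadForm_eq_zero A (toEuclideanCLM (𝕜 := ℝ) (U⁻¹ * CFC.sqrt C)) h i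
    (by
      rw [EuclideanSpace.single, PiLp.single, toEuclideanCLM_toLp]
      exact hi.ne') c
  convert this using 2
  ext z
  simp only [zero_add, Set.preimage_ofPred_eq, Set.mem_ofPred_eq, ofLp_toEuclideanCLM,
    mulVec_mulVec]
  rfl

end Atoms

section SampleSizes

lemma effSize_pos {mn md : ℕ} (hn : 0 < mn) (hd : 0 < md) : 0 < effSize mn md := by
  unfold effSize
  positivity

lemma tendsto_effSize {mn md : ℕ → ℕ} (hmn_pos : ∀ k, 0 < mn k) (hmd_pos : ∀ k, 0 < md k)
    (hmn : Tendsto mn atTop atTop) (hmd : Tendsto md atTop atTop) :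
    Tendsto (fun k => effSize (mn k) (md k)) atTop atTop := by
  have h1 : Tendsto (fun k => (effSize (mn k) (md k))⁻¹) atTop (𝓝[>] 0) := by
    rw [tendsto_nhdsWithin_iff]
    refine ⟨?_, Eventually.of_forall fun k => inv_pos.2 (effSize_pos (hmn_pos k) (hmd_pos k))⟩
    have h2 : Tendsto (fun k => ((md k : ℝ))⁻¹ + ((mn k : ℝ))⁻¹) atTop (𝓝 (0 + 0)) :=
      (tendsto_inv_atTop_zero.comp (tendsto_natCast_atTop_atTop.comp hmd)).add
        (tendsto_inv_atTop_zero.comp (tendsto_natCast_atTop_atTop.comp hmn))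
    rw [add_zero] at h2
    refine h2.congr fun k => ?_
    have := (hmn_pos k).ne'
    have := (hmd_pos k).ne'
    unfold effSize
    field_simp
  exact h1.inv_tendsto_nhdsGT_zero.congr fun k => inv_inv _

end SampleSizes

section Measurability

variable {X : Type*} [MeasurableSpace X] {q : ℕ} {φ : X → Vec q → ℝ}

lemma measurable_ratio (hφ : ∀ β, Measurable fun x => φ x β) (θ : Vec (q + 1)) :
    Measurable fun x => ratio φ x θ :=
  Real.measurable_exp.comp (measurable_const.add (hφ _))

lemma measurable_gradRatio (hφ : ∀ β, Measurable fun x => φ x β)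
    (hφd : ∀ x, Differentiable ℝ (φ x)) (θ : Vec (q + 1)) :
    Measurable fun x => gradRatio φ x θ := by
  have h : ∀ i, Measurable fun x => gradRatio φ x θ i := fun i => by
    have hlim : ∀ x, Tendsto (fun n : ℕ => (n : ℝ) •
        (ratio φ x (θ + (n : ℝ)⁻¹ • EuclideanSpace.single i 1) - ratio φ x θ)) atTop
        (𝓝 (gradRatio φ x θ i)) := fun x => by
      have h1 := ((differentiable_ratio hφd x θ).hasFDerivAt.lim_real
        (EuclideanSpace.single i 1)).comp tendsto_natCast_atTop_atTop
      have h2 : gradRatio φ x θ i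
          = fderiv ℝ (ratio φ x) θ (EuclideanSpace.single i 1) := by
        rw [← inner_gradient_left, EuclideanSpace.inner_single_right]
        simp [gradRatio]
      rw [h2]
      exact h1
    refine measurable_of_tendsto_metrizable (fun n => ?_) (tendsto_pi_nhds.2 hlim)
    exact ((measurable_ratio hφ _).sub (measurable_ratio hφ _)).const_smul (n : ℝ)
  exact (WithLp.measurable_toLp 2 (Fin (q + 1) → ℝ)).comp (measurable_pi_lambda _ h)

lemma measurable_fD_ratio {f : ℝ → ℝ} (hf : ConvexOn ℝ (Set.Ioi 0) f) {ρ : ℝ} (hρ : 0 < ρ)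
    (hφ : ∀ β, Measurable fun x => φ x β) (θ : Vec (q + 1)) :
    Measurable fun x => fD f ρ (ratio φ x θ) :=
  (continuous_fD_exp hf hρ).measurable.comp (measurable_const.add (hφ _))

end Measurability

section SampleRatio

variable {f : ℝ → ℝ} {ρ ρ' r : ℝ}

lemma abs_fD_sub_le (hρ : 0 < ρ) (hρ' : 0 < ρ') (hr : 0 < r) (hf : 0 ≤ f r) :
    |fD f ρ' r - fD f ρ r| ≤ |ρ' - ρ| / ρ' * fD f ρ r := by
  have h1 : fD f ρ' r - fD f ρ r = -(ρ' - ρ) * (r / (1 + ρ' * r)) * fD f ρ r := by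
    unfold fD; field_simp; ring
  have h2 : 0 ≤ fD f ρ r := by unfold fD; positivity
  rw [h1, abs_mul, abs_mul, abs_neg, abs_of_nonneg h2, div_eq_mul_inv |ρ' - ρ|]
  gcongr
  rw [abs_of_nonneg (by positivity), inv_eq_one_div, div_le_div_iff₀ (by positivity) hρ']
  nlinarith

lemma abs_fN_sub_le (hρ : 0 < ρ) (hρ' : 0 < ρ') (hr : 0 < r) (hf : 0 ≤ f r) :
    |fN f ρ' r - fN f ρ r| ≤ |ρ' - ρ| / ρ * fN f ρ r := by
  have h1 : fN f ρ' r - fN f ρ r = (ρ' - ρ) * ((1 / (1 + ρ' * r)) / ρ) * fN f ρ r := by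
    unfold fN; field_simp; ring
  have h2 : 0 ≤ fN f ρ r := by unfold fN; positivity
  rw [h1, abs_mul, abs_mul, abs_of_nonneg h2,
    abs_of_nonneg (by positivity : 0 ≤ (1 / (1 + ρ' * r)) / ρ), ← mul_div_assoc]
  gcongr
  refine mul_le_of_le_one_right (abs_nonneg _) ?_
  rw [div_le_one (by positivity)]
  nlinarith [mul_pos hρ' hr]

end SampleRatio

section QuadraticLimits

variable {Ω : ℕ → Type*} [∀ k, MeasurableSpace (Ω k)] {μ : ∀ k, Measure (Ω k)} {d : ℕ}

lemma tendstoInProb_quadForm_sub (A : Matrix (Fin d) (Fin d) ℝ) {Y Z : ∀ k, Ω k → Vec d}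
    (hY : BoundedInProb μ fun k ω => ‖Y k ω‖) (hZ : BoundedInProb μ fun k ω => ‖Z k ω‖)
    (hYZ : TendstoInProb μ (fun k ω => ‖Y k ω - Z k ω‖) 0) :
    TendstoInProb μ (fun k ω => quadForm A (Y k ω) - quadForm A (Z k ω)) 0 := by
  have hcoord : ∀ {W : ∀ k, Ω k → Vec d}, BoundedInProb μ (fun k ω => ‖W k ω‖) → ∀ i,
      BoundedInProb μ fun k ω => W k ω i := fun hW i =>
    hW.of_abs_le zero_le_one le_rfl (Eventually.of_forall fun k ω => by
      simpa using abs_apply_le_norm _ i)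
  have hsub : ∀ i, TendstoInProb μ (fun k ω => Y k ω i - Z k ω i) 0 := fun i =>
    hYZ.of_abs_le (Eventually.of_forall fun k => ae_of_all _ fun ω => by
      simpa using abs_apply_le_norm (Y k ω - Z k ω) i)
  have h1 : ∀ i j, TendstoInProb μ (fun k ω => A i j * ((Y k ω i - Z k ω i) * Y k ω j
      + (Y k ω j - Z k ω j) * Z k ω i)) 0 := fun i j => by
    have := (((hsub i).mul_bounded (hcoord hY j)).add
      ((hsub j).mul_bounded (hcoord hZ i))).const_mul (A i j)
    simpa using this
  have h2 := TendstoInProb.sum Finset.univ fun i _ =>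
    TendstoInProb.sum Finset.univ fun j _ => h1 i j
  simp only [Finset.sum_const_zero] at h2
  refine h2.congr fun k => ae_of_all _ fun ω => ?_
  simp only [quadForm_eq_sum, ← Finset.sum_sub_distrib]
  exact Finset.sum_congr rfl fun i _ => Finset.sum_congr rfl fun j _ => by ring

/-- A random vector that converges in distribution, after deterministic affine changes of
variables that converge. -/
lemma tendstoInProb_affine [∀ k, IsProbabilityMeasure (μ k)] {U : ℕ → Matrix (Fin d) (Fin d) ℝ}
    {U₀ : Matrix (Fin d) (Fin d) ℝ} (hU : Tendsto U atTop (𝓝 U₀)) (hU₀ : U₀.det ≠ 0)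
    {H : ℕ → Vec d} {h : Vec d} (hH : Tendsto H atTop (𝓝 h)) {W Y : ∀ k, Ω k → Vec d}
    (hW : BoundedInProb μ fun k ω => ‖W k ω‖)
    (hY : ∀ k ω, W k ω = WithLp.toLp 2 ((U k).mulVec (Y k ω - H k).ofLp)) :
    TendstoInProb μ (fun k ω => ‖Y k ω - (WithLp.toLp 2 (U₀⁻¹.mulVec (W k ω).ofLp) + h)‖) 0 := by
  set T : Matrix (Fin d) (Fin d) ℝ → (Vec d →L[ℝ] Vec d) := fun A =>
    Matrix.toEuclideanCLM (𝕜 := ℝ) A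
  have hTc : Continuous T :=
    LinearMap.continuous_of_finiteDimensional
      (Matrix.toEuclideanCLM (n := Fin d) (𝕜 := ℝ)).toAlgEquiv.toLinearMap
  have hdet : ∀ᶠ k in atTop, (U k).det ≠ 0 :=
    ((continuous_id.matrix_det.tendsto U₀).comp hU).eventually_ne hU₀
  have hinv : Tendsto (fun k => (U k)⁻¹) atTop (𝓝 U₀⁻¹) := by
    simp only [Matrix.inv_def, Ring.inverse_eq_inv']
    exact (((continuous_id.matrix_det.tendsto U₀).comp hU).inv₀ hU₀).smul
      ((continuous_id.matrix_adjugate.tendsto U₀).comp hU)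
  have hT : Tendsto (fun k => ‖T (U k)⁻¹ - T U₀⁻¹‖) atTop (𝓝 0) :=
    tendsto_iff_norm_sub_tendsto_zero.1 ((hTc.tendsto _).comp hinv)
  have hH' : Tendsto (fun k => ‖H k - h‖) atTop (𝓝 0) := tendsto_iff_norm_sub_tendsto_zero.1 hH
  have h1 := ((tendstoInProb_of_tendsto (μ := μ) hT).mul_bounded hW).add
    (tendstoInProb_of_tendsto (μ := μ) hH')
  rw [add_zero] at h1
  refine h1.of_abs_le ?_
  filter_upwards [hdet] with k hk
  refine ae_of_all _ fun ω => ?_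
  have hYk : Y k ω = T (U k)⁻¹ (W k ω) + H k := by
    rw [hY, Matrix.toEuclideanCLM_toLp, Matrix.mulVec_mulVec,
      Matrix.nonsing_inv_mul _ (isUnit_iff_ne_zero.2 hk), Matrix.one_mulVec]
    simp
  have h2 : Y k ω - (WithLp.toLp 2 (U₀⁻¹.mulVec (W k ω).ofLp) + h)
      = (T (U k)⁻¹ - T U₀⁻¹) (W k ω) + (H k - h) := by
    rw [hYk]
    change T (U k)⁻¹ (W k ω) + H k - (T U₀⁻¹ (W k ω) + h) = _
    rw [_root_.sub_apply]
    abel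
  rw [sub_zero, abs_norm, h2]
  refine (norm_add_le _ _).trans (le_trans ?_ (le_abs_self _))
  gcongr
  exact ContinuousLinearMap.le_opNorm _ _

end QuadraticLimits

section Model

/-- At `θ*` the matrix `U` is proportional to `M`. -/
lemma matU_eq_smul_matM {X : Type*} [MeasurableSpace X] {P : Measure X} {q : ℕ}
    {φ : X → Vec q → ℝ} {θstar : Vec (q + 1)} {ρ : ℝ} (hstar : ∀ x, ratio φ x θstar = 1) :
    matU P φ ρ θstar = (1 + ρ)⁻¹ • matM P φ θstar := by
  ext i j
  simp only [matU, matM, Matrix.of_apply, Matrix.smul_apply, hstar, mul_one, integral_const_mul,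
    smul_eq_mul]

variable {X : Type*} [MeasurableSpace X] {P : Measure X} [IsProbabilityMeasure P] {q : ℕ}
  {φ : X → Vec q → ℝ} {θstar : Vec (q + 1)} {f : ℝ → ℝ} {ρ : ℝ}

/-- Quadratic approximation of the average of `f_d (r (x; θ))` over one sample. -/
lemma tendstoInProb_sampleMean_fD {Ω : ℕ → Type*} [∀ k, MeasurableSpace (Ω k)]
    {μ : ∀ k, Measure (Ω k)} {n : ℕ → ℕ} {ξ : ∀ k, Ω k → Fin (n k) → X}
    (hS : AsymptoticSample P μ ξ) (hφ_meas : ∀ β, Measurable fun x => φ x β)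
    (hφ_diff : ∀ x, Differentiable ℝ (φ x)) (hstar : ∀ x, ratio φ x θstar = 1)
    (hf_conv : ConvexOn ℝ (Set.Ioi 0) f) (hf_diff : ContDiffAt ℝ 2 f 1)
    (hf_one : f 1 = 0) (hf_deriv : deriv f 1 = 0) (hf_deriv2 : 0 < deriv (deriv f) 1) (hρ : 0 < ρ)
    (hv2 : ∀ i, MemLp (fun x => gradRatio φ x θstar i) 2 P)
    {G : X → ℝ} (hG_meas : Measurable G) (hG_int : Integrable G P)
    (hG_dom : ∃ δ > 0, ∀ᵐ x ∂P, ∀ t, ‖t - θstar‖ < δ →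
      fD f ρ (ratio φ x t) ≤ G x * ‖t - θstar‖ ^ 2)
    (hG_lln : TendstoInProb μ (fun k ω => sampleMean G (ξ k ω)) (∫ x, G x ∂P))
    (hM_lln : ∀ i j, TendstoInProb μ
      (fun k ω => sampleMean (fun x => gradRatio φ x θstar i * gradRatio φ x θstar j) (ξ k ω))
      (∫ x, gradRatio φ x θstar i * gradRatio φ x θstar j ∂P))
    {m : ℕ → ℝ} (hm0 : ∀ k, 0 < m k) (hm : Tendsto m atTop atTop)
    {Y : ∀ k, Ω k → Vec (q + 1)} (hY : BoundedInProb μ fun k ω => ‖Y k ω‖) :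
    TendstoInProb μ (fun k ω =>
      m k * sampleMean (fun x => fD f ρ (ratio φ x (θstar + (√(m k))⁻¹ • Y k ω))) (ξ k ω)
      - deriv (deriv f) 1 / (2 * (1 + ρ)) * quadForm (Matrix.of fun i j =>
        ∫ x, gradRatio φ x θstar i * gradRatio φ x θstar j ∂P) (Y k ω)) 0 := by
  set κ := deriv (deriv f) 1 / (2 * (1 + ρ)) with hκ
  have hκ0 : 0 ≤ κ := by positivity
  have hv := measurable_gradRatio hφ_meas hφ_diff θstar
  have hvi : ∀ i, Measurable fun x => gradRatio φ x θstar i := fun i =>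
    (measurable_pi_apply i).comp ((WithLp.measurable_ofLp 2 (Fin (q + 1) → ℝ)).comp hv)
  have hvint : ∀ i j, Integrable (fun x => gradRatio φ x θstar i * gradRatio φ x θstar j) P :=
    fun i j => (hv2 i).integrable_mul (hv2 j)
  obtain ⟨δ, hδ, hdom⟩ := hG_dom
  have hfD0 : ∀ x θ, 0 ≤ fD f ρ (ratio φ x θ) := fun x θ =>
    div_nonneg (nonneg_of_convexOn hf_conv hf_diff hf_one hf_deriv hf_deriv2 (ratio_pos x θ))
      (by have := ratio_pos (φ := φ) x θ; positivity)
  refine tendstoInProb_sampleMean_quadratic hS (v := fun x => gradRatio φ x θstar)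
    (g := fun x t => fD f ρ (ratio φ x (θstar + t)))
    (B := fun x => G x + κ * ∑ i, gradRatio φ x θstar i * gradRatio φ x θstar i)
    (fun t => measurable_fD_ratio hf_conv hρ hφ_meas _) hv
    (fun x => (continuous_fD_ratio hf_conv hρ hφ_diff x).comp (continuous_const.add continuous_id))
    (fun x => by simp [hstar, fD, hf_one])
    (fun x => isLittleO_fD_ratio hρ hf_diff hf_one hf_deriv hφ_diff x (hstar x))
    (hG_meas.add ((Finset.measurable_sum _ fun i _ => (hvi i).mul (hvi i)).const_mul κ))
    (hG_int.add ((integrable_finsetSum _ fun i _ => hvint i i).const_mul κ)) hδ ?_ ?_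
    (fun i j => hM_lln i j) hm0 hm hY
  · filter_upwards [hdom] with x hx
    have hsq : ‖gradRatio φ x θstar‖ ^ 2 = ∑ i, gradRatio φ x θstar i * gradRatio φ x θstar i := by
      rw [EuclideanSpace.real_norm_sq_eq]
      exact Finset.sum_congr rfl fun i _ => sq _
    have hdom' : ∀ t, ‖t‖ < δ → fD f ρ (ratio φ x (θstar + t)) ≤ G x * ‖t‖ ^ 2 := fun t ht => by
      simpa using hx (θstar + t) (by simpa using ht)
    have hG0 : 0 ≤ G x := by
      set t : Vec (q + 1) := EuclideanSpace.single 0 (δ / 2) with ht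
      have htn : ‖t‖ = δ / 2 := by
        rw [ht, PiLp.norm_single, Real.norm_eq_abs, abs_of_pos (by positivity)]
      have := (hfD0 x _).trans (hdom' t (by rw [htn]; linarith))
      exact nonneg_of_mul_nonneg_left this (by rw [htn]; positivity)
    rw [← hsq]
    refine ⟨by positivity, fun t ht => ?_⟩
    have h1 := hdom' t ht
    have h2 := hfD0 x (θstar + t)
    have h3 : κ * inner ℝ (gradRatio φ x θstar) t ^ 2
        ≤ κ * (‖gradRatio φ x θstar‖ ^ 2 * ‖t‖ ^ 2) := by
      rw [← mul_pow, ← sq_abs]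
      gcongr
      exact abs_real_inner_le_norm _ _
    have h4 : 0 ≤ κ * inner ℝ (gradRatio φ x θstar) t ^ 2 := by positivity
    have h5 : 0 ≤ G x * ‖t‖ ^ 2 := by positivity
    rw [abs_le]
    constructor <;> nlinarith
  · have h1 := hG_lln.add ((TendstoInProb.sum Finset.univ fun i _ => hM_lln i i).const_mul κ)
    rw [integral_add hG_int ((integrable_finsetSum _ fun i _ => hvint i i).const_mul κ),
      integral_const_mul, integral_finsetSum _ fun i _ => hvint i i]
    refine h1.congr fun k => ae_of_all _ fun ω => ?_
    rw [sampleMean_add, sampleMean_const_mul, sampleMean_sum]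

/-- Convergence in probability of the densities of the local alternatives. -/
lemma tendstoInProb_density (hφ_meas : ∀ β, Measurable fun x => φ x β)
    (hφ_diff : ∀ x, Differentiable ℝ (φ x)) (hstar : ∀ x, ratio φ x θstar = 1)
    {m : ℕ → ℝ} (hm : Tendsto m atTop atTop) {θ : ℕ → Vec (q + 1)}
    (hθ : Tendsto θ atTop (𝓝 θstar)) {s : ℕ → X → ℝ}
    (hs_small : TendstoInMeasure P (fun k x => s k x / √(m k)) atTop 0)
    {e : ℕ → ℝ} {ε : ℝ} (he : Tendsto e atTop (𝓝 ε)) :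
    TendstoInProb (fun _ : ℕ => P) (fun k x => ratio φ x (θ k) + (s k x + e k) / √(m k)) 1 := by
  have hconv : ∀ (u : ℕ → X → ℝ) (c : ℝ), TendstoInMeasure P u atTop (fun _ => c) →
      TendstoInProb (fun _ : ℕ => P) u c := fun u c hu δ hδ => by
    refine tendsto_of_tendsto_of_tendsto_of_le_of_le tendsto_const_nhds
      (tendstoInMeasure_iff_norm.1 hu δ hδ) (fun _ => zero_le) fun k => ?_
    exact measure_mono fun x (hx : δ < _) => hx.le
  have h1 : TendstoInProb (fun _ : ℕ => P) (fun k x => ratio φ x (θ k)) 1 := by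
    refine hconv _ _ (tendstoInMeasure_of_tendsto_ae
      (fun k => (measurable_ratio hφ_meas _).aestronglyMeasurable) (ae_of_all _ fun x => ?_))
    have := ((differentiable_ratio hφ_diff x).continuous.tendsto θstar).comp hθ
    rwa [hstar x] at this
  have h2 : Tendsto (fun k => e k / √(m k)) atTop (𝓝 0) :=
    he.div_atTop (Real.tendsto_sqrt_atTop.comp hm)
  have h3 := (h1.add (hconv _ 0 hs_small)).add (tendstoInProb_of_tendsto (μ := fun _ : ℕ => P) h2)
  simp only [add_zero] at h3
  refine h3.congr fun k => ae_of_all _ fun x => ?_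
  ring

/-- The covariance form of `∇ r` only involves the `β`-part. -/
lemma quadForm_covMat_betaPart (hφ_diff : ∀ x, Differentiable ℝ (φ x))
    (hstar : ∀ x, ratio φ x θstar = 1) (y : Vec (q + 1)) :
    quadForm (covMat P fun x => gradient (φ x) (betaPart θstar)) (betaPart y)
      = quadForm (covMat P fun x => gradRatio φ x θstar) y := by
  have hgrad : (fun x => gradRatio φ x θstar) = fun x => gradLogRatio φ x θstar :=
    funext fun x => gradRatio_eq_gradLogRatio hφ_diff hstar x
  rw [hgrad, quadForm_eq_sum, quadForm_eq_sum]
  simp only [Fin.sum_univ_succ, covMat, Matrix.of_apply, gradLogRatio_zero hφ_diff,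
    gradLogRatio_succ hφ_diff, covariance_const_left, covariance_const_right, zero_mul,
    Finset.sum_const_zero, zero_add]
  rfl

end Model

section Estimators

variable {X : Type*} {q mn md : ℕ} {φ : X → Vec q → ℝ} {f : ℝ → ℝ} {ρ : ℝ}

/-- Replacing the sample ratio by another value in the decomposition changes `D̂_f` by a small
relative error. -/
lemma abs_divEst_sub_le (hf : ∀ t, 0 < t → 0 ≤ f t) (hρ : 0 < ρ) (hmn : 0 < mn) (hmd : 0 < md)
    (ω : Samples X mn md) (θ : Vec (q + 1)) :
    |divEst f φ ω θ - (sampleMean (fun x => fD f ρ (ratio φ x θ)) ω.2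
        + ρ * sampleMean (fun x => fD f ρ (ratio φ x θ)) ω.1)|
      ≤ (|sampleRatio mn md - ρ| / sampleRatio mn md + |sampleRatio mn md - ρ| / ρ)
        * (sampleMean (fun x => fD f ρ (ratio φ x θ)) ω.2
          + ρ * sampleMean (fun x => fD f ρ (ratio φ x θ)) ω.1) := by
  set ρ' := sampleRatio mn md
  have hρ' : 0 < ρ' := by simp only [ρ', sampleRatio]; positivity
  have hfN : ∀ x, ρ * fD f ρ (ratio φ x θ) = fN f ρ (ratio φ x θ) := fun x => by
    unfold fD fN; ring
  rw [← sampleMean_const_mul]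
  simp only [hfN]
  have hd : |sampleMean (fun x => fD f ρ' (ratio φ x θ)) ω.2
      - sampleMean (fun x => fD f ρ (ratio φ x θ)) ω.2|
      ≤ |ρ' - ρ| / ρ' * sampleMean (fun x => fD f ρ (ratio φ x θ)) ω.2 := by
    rw [← sampleMean_sub, ← sampleMean_const_mul]
    exact abs_sampleMean_le fun j => abs_fD_sub_le hρ hρ' (ratio_pos _ _) (hf _ (ratio_pos _ _))
  have hn : |sampleMean (fun x => fN f ρ' (ratio φ x θ)) ω.1
      - sampleMean (fun x => fN f ρ (ratio φ x θ)) ω.1|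
      ≤ |ρ' - ρ| / ρ * sampleMean (fun x => fN f ρ (ratio φ x θ)) ω.1 := by
    rw [← sampleMean_sub, ← sampleMean_const_mul]
    exact abs_sampleMean_le fun j => abs_fN_sub_le hρ hρ' (ratio_pos _ _) (hf _ (ratio_pos _ _))
  have hdiv : divEst f φ ω θ = sampleMean (fun x => fD f ρ' (ratio φ x θ)) ω.2
      + sampleMean (fun x => fN f ρ' (ratio φ x θ)) ω.1 := rfl
  have hpos : ∀ x, 0 ≤ fD f ρ (ratio φ x θ) := fun x => by
    have := ratio_pos (φ := φ) x θ
    exact div_nonneg (hf _ this) (by positivity)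
  have hd0 : 0 ≤ sampleMean (fun x => fD f ρ (ratio φ x θ)) ω.2 :=
    sampleMean_nonneg fun j => hpos _
  have hn0 : 0 ≤ sampleMean (fun x => fN f ρ (ratio φ x θ)) ω.1 :=
    sampleMean_nonneg fun j => by rw [← hfN]; exact mul_nonneg hρ.le (hpos _)
  have h1 : 0 ≤ |ρ' - ρ| / ρ' := by positivity
  have h2 : 0 ≤ |ρ' - ρ| / ρ := by positivity
  rw [hdiv, add_sub_add_comm]
  refine (abs_add_le _ _).trans ((add_le_add hd hn).trans ?_)
  nlinarith [mul_nonneg h1 hn0, mul_nonneg h2 hd0]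

lemma elStat_eq_quadForm {m : ℝ} (hm : 0 ≤ m) (θstar θ : Vec (q + 1))
    (V : Matrix (Fin q) (Fin q) ℝ) :
    elStat m θstar θ V = quadForm V (betaPart (√m • (θ - θstar))) := by
  have : betaPart (√m • (θ - θstar)) = √m • betaPart (θ - θstar) :=
    (betaPartL q).map_smul _ _
  rw [this, elStat, quadForm, WithLp.ofLp_smul, Matrix.mulVec_smul, dotProduct_smul,
    smul_dotProduct, smul_smul, Real.mul_self_sqrt hm, smul_eq_mul]

lemma rejectDiv_eq {c : ℝ} (hc : deriv (deriv f) 1 = c) (hc0 : 0 < c) (hmn : 0 < mn)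
    (hmd : 0 < md) (a : ℝ) (θhat : Samples X mn md → Vec (q + 1)) :
    rejectDiv f φ a θhat = {ω | chiSquareQuantile q (1 - a)
      ≤ 2 * effSize mn md / c * divEst f φ ω (θhat ω)} := by
  ext ω
  have hm := effSize_pos hmn hmd
  rw [rejectDiv, Set.mem_ofPred_eq, Set.mem_ofPred_eq, hc, div_mul_eq_mul_div,
    div_le_iff₀ (by positivity), div_mul_eq_mul_div, le_div_iff₀ hc0, mul_comm c,
    mul_comm (divEst _ _ _ _)]

end Estimators

section Samples

variable {X : Type*} [MeasurableSpace X] {P : Measure X} [IsProbabilityMeasure P] {q : ℕ}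
  {φ : X → Vec q → ℝ} {θstar : Vec (q + 1)} {mn md : ℕ → ℕ}

/-- The samples from local alternatives. -/
lemma asymptoticSample_altLaw (hφ_meas : ∀ β, Measurable fun x => φ x β)
    (hφ_diff : ∀ x, Differentiable ℝ (φ x)) (hstar : ∀ x, ratio φ x θstar = 1)
    (hmn_pos : ∀ k, 0 < mn k) (hmn : Tendsto mn atTop atTop)
    {m : ℕ → ℝ} (hm : Tendsto m atTop atTop) {θ : ℕ → Vec (q + 1)}
    (hθ : Tendsto θ atTop (𝓝 θstar)) {s : ℕ → X → ℝ} (hs_meas : ∀ k, Measurable (s k))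
    (hs_small : TendstoInMeasure P (fun k x => s k x / √(m k)) atTop 0)
    {e : ℕ → ℝ} {ε : ℝ} (he : Tendsto e atTop (𝓝 ε)) {Pn : ℕ → Measure X}
    (hPn : ∀ k, Pn k = altLaw P φ (θ k) (s k) (e k) (m k)) [∀ k, IsProbabilityMeasure (Pn k)] :
    AsymptoticSample P (fun k => sampleLaw (Pn k) P (mn k) (md k))
      (fun k (ω : Samples X (mn k) (md k)) => ω.1) := by
  refine asymptoticSample_of_tendsto (Q := Pn) (fun k => ?_) hmn hmn_pos (fun g hg ⟨c, hc⟩ => ?_)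
    fun k => measurePreserving_fst
  · rw [hPn k]
    exact withDensity_absolutelyContinuous _ _
  · simp only [hPn]
    refine tendsto_integral_withDensity (fun k => ?_)
      (tendstoInProb_density hφ_meas hφ_diff hstar hm hθ hs_small he) (fun k => ?_) hg hc
    · exact (measurable_ratio hφ_meas _).add (((hs_meas k).add_const _).div_const _)
    · have : IsProbabilityMeasure (Pn k) := inferInstance
      rwa [hPn k] at this

end Samples

section Limits

variable {q d : ℕ}

lemma abs_quadForm_le (B : Matrix (Fin d) (Fin d) ℝ) (y : Vec d) :
    |quadForm B y| ≤ ‖Matrix.toEuclideanCLM (𝕜 := ℝ) B‖ * ‖y‖ ^ 2 := by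
  have h1 : quadForm B y = inner ℝ (Matrix.toEuclideanCLM (𝕜 := ℝ) B y) y := by
    rw [EuclideanSpace.inner_eq_star_dotProduct, Matrix.ofLp_toEuclideanCLM]
    rfl
  rw [h1, sq, ← mul_assoc]
  exact (abs_real_inner_le_norm _ _).trans
    (mul_le_mul_of_nonneg_right (ContinuousLinearMap.le_opNorm _ _) (norm_nonneg _))

/-- The limits of quadratic statistics whose matrix dominates `C` have no atoms. -/
lemma multivariateGaussian_quadForm_affine_eq_zero (hq : 1 ≤ q)
    {B C M U : Matrix (Fin (q + 1)) (Fin (q + 1)) ℝ} (hC : C.PosSemidef) {u : Fin (q + 1) → ℝ}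
    (hM : M = C + Matrix.vecMulVec u u) (hMdet : M.det ≠ 0) {t s : ℝ} (ht : t ≠ 0) (hs : 0 < s)
    (hU : U = t • M) (hB : ∀ y, quadForm C y ≤ quadForm B y) (h : Vec (q + 1)) (c : ℝ) :
    multivariateGaussian (0 : Vec (q + 1)) (s • C)
      {w | quadForm B (WithLp.toLp 2 (U⁻¹.mulVec w.ofLp) + h) = c} = 0 := by
  open scoped MatrixOrder in
  obtain ⟨i, hi⟩ := exists_quadForm_pos hq hC hM hMdet ht hs.ne' hU
    (CFC.sqrt_mul_sqrt_self _ (hC.smul hs.le).nonneg)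
  exact multivariateGaussian_quadForm_eq_zero h (hi.trans_le (hB _)) c

end Limits

end DensityRatio

end

open DensityRatio in
/-- Asymptotic power comparison of the `D̂_f`-based test and the empirical likelihood test for a
slightly misspecified density ratio under local alternatives. -/
theorem theorem4 {X : Type*} [MeasurableSpace X] (P : Measure X) [IsProbabilityMeasure P]
    {q : ℕ} (hq : 1 ≤ q)
    -- the density ratio model `r(x; θ) = exp (α + φ(x; β))`, with `r(x; θ*) = 1`
    (φ : X → Vec q → ℝ) (hφ_meas : ∀ β, Measurable fun x => φ x β)
    (hφ_diff : ∀ x, Differentiable ℝ (φ x))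
    (θstar : Vec (q + 1)) (hstar : ∀ x, ratio φ x θstar = 1)
    -- the convex function of the `f`-divergence
    (f : ℝ → ℝ) (hf_conv : ConvexOn ℝ (Set.Ioi 0) f) (hf_diff : ContDiffAt ℝ 2 f 1)
    (hf_one : f 1 = 0) (hf_deriv : deriv f 1 = 0) (hf_deriv2 : 0 < deriv (deriv f) 1)
    -- sample sizes
    (mn md : ℕ → ℕ) (hmn_pos : ∀ k, 0 < mn k) (hmd_pos : ∀ k, 0 < md k)
    (hmn : Tendsto mn atTop atTop) (hmd : Tendsto md atTop atTop)
    (ρ : ℝ) (hρ : 0 < ρ)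
    (hratio : Tendsto (fun k => sampleRatio (mn k) (md k)) atTop (𝓝 ρ))
    -- local parameters `θ_m = θ* + h_m / √m`
    (H : ℕ → Vec (q + 1)) (h : Vec (q + 1)) (hH : Tendsto H atTop (𝓝 h))
    (θ : ℕ → Vec (q + 1)) (hθ : ∀ k, θ k = θstar + (√(effSize (mn k) (md k)))⁻¹ • H k)
    -- misspecified local alternatives `p (r(x; θ_m) + (s_m(x) + ε_m) / √m)`
    (s : ℕ → X → ℝ) (hs_meas : ∀ k, Measurable (s k)) (hs_int : ∀ k, Integrable (s k) P)
    (hs_mean : ∀ k, ∫ x, s k x ∂P = 0)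
    (hs_small : TendstoInMeasure P (fun k x => s k x / √(effSize (mn k) (md k))) atTop 0)
    (e : ℕ → ℝ) (ε : ℝ) (he : Tendsto e atTop (𝓝 ε))
    (hdens : ∀ k, ∀ᵐ x ∂P,
      0 ≤ ratio φ x (θ k) + (s k x + e k) / √(effSize (mn k) (md k)))
    (Pn : ℕ → Measure X)
    (hPn : ∀ k, Pn k = altLaw P φ (θ k) (s k) (e k) (effSize (mn k) (md k)))
    [∀ k, IsProbabilityMeasure (Pn k)]
    -- `M` and `U` are defined, continuous and non-degenerate in a neighbourhood of `θ*`
    (N : Set (Vec (q + 1))) (hN : N ∈ 𝓝 θstar)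
    (hMU_int : ∀ t ∈ N, ∀ i, MemLp (fun x => gradLogRatio φ x t i) 2 P)
    (hM_cont : ContinuousOn (matM P φ) N) (hM_det : ∀ t ∈ N, (matM P φ t).det ≠ 0)
    (hU_cont : ContinuousOn (matU P φ ρ) N) (hU_det : ∀ t ∈ N, (matU P φ ρ t).det ≠ 0)
    -- second-order domination of `f_d (r(x; θ))` near `θ*`
    (G : X → ℝ) (hG_meas : Measurable G) (hG_int : Integrable G P)
    (hG_dom : ∃ δ > 0, ∀ᵐ x ∂P, ∀ t, ‖t - θstar‖ < δ →
      fD f ρ (ratio φ x t) ≤ G x * ‖t - θstar‖ ^ 2)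
    (hG_lln : TendstoInProb (fun k => sampleLaw (Pn k) P (mn k) (md k))
      (fun k ω => (mn k : ℝ)⁻¹ * ∑ j, G (ω.1 j)) (∫ x, G x ∂P))
    -- law of large numbers for `∇ r (∇ r)ᵀ` over the sample from the local alternative
    (hM_lln : ∀ i i', TendstoInProb (fun k => sampleLaw (Pn k) P (mn k) (md k))
      (fun k ω => (mn k : ℝ)⁻¹ *
        ∑ j, gradRatio φ (ω.1 j) θstar i * gradRatio φ (ω.1 j) θstar i')
      (matM P φ θstar i i'))
    -- the estimator of `θ`: an (asymptotic) solution of the estimating equation given by `η_opt`,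
    -- asymptotically normal under the local alternatives
    (θhat : ∀ k, Samples X (mn k) (md k) → Vec (q + 1)) (hθhat_meas : ∀ k, Measurable (θhat k))
    (hθhat_eq : ∀ i, TendstoInProb (fun k => sampleLaw (Pn k) P (mn k) (md k))
      (fun k ω => estFun φ (etaOpt φ (sampleRatio (mn k) (md k))) ω (θhat k ω) i) 0)
    (hθhat_clt : TendstoInDistribution
      (fun k ω => (WithLp.toLp 2 (√(effSize (mn k) (md k)) •
        (matU P φ ρ (θ k)).mulVec (θhat k ω - θ k).ofLp) : Vec (q + 1)))
      atTop id (fun k => sampleLaw (Pn k) P (mn k) (md k))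
      (multivariateGaussian (0 : Vec (q + 1))
        (((1 + ρ) ^ 2)⁻¹ • covMat P fun x => gradRatio φ x θstar)))
    -- a consistent estimator of the variance-covariance matrix of `∇_β φ`
    (Vhat : ∀ k, Samples X (mn k) (md k) → Matrix (Fin q) (Fin q) ℝ)
    (hVhat_meas : ∀ k i j, Measurable fun ω => Vhat k ω i j)
    (hVhat : ∀ i j, TendstoInProb (fun k => sampleLaw (Pn k) P (mn k) (md k))
      (fun k ω => Vhat k ω i j)
      (covMat P (fun x => gradient (φ x) (betaPart θstar)) i j))
    -- the level of the tests
    (a : ℝ) (ha0 : 0 < a) (ha1 : a < 1) :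
    ∃ powD powS : ℝ,
      Tendsto (fun k => (sampleLaw (Pn k) P (mn k) (md k)).real (rejectDiv f φ a (θhat k)))
        atTop (𝓝 powD) ∧
      Tendsto (fun k => (sampleLaw (Pn k) P (mn k) (md k)).real
        (rejectEL θstar a (θhat k) (Vhat k))) atTop (𝓝 powS) ∧
      powS ≤ powD := by
  set m : ℕ → ℝ := fun k => effSize (mn k) (md k)
  set μ := fun k => sampleLaw (Pn k) P (mn k) (md k)
  have hm0 : ∀ k, 0 < m k := fun k => effSize_pos (hmn_pos k) (hmd_pos k)
  have hm : Tendsto m atTop atTop := tendsto_effSize hmn_pos hmd_pos hmn hmd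
  have hsqrt : ∀ k, 0 < √(m k) := fun k => Real.sqrt_pos.2 (hm0 k)
  have hsqrt_inv : Tendsto (fun k => (√(m k))⁻¹) atTop (𝓝 0) :=
    tendsto_inv_atTop_zero.comp (Real.tendsto_sqrt_atTop.comp hm)
  have hθ_lim : Tendsto θ atTop (𝓝 θstar) := by
    have := tendsto_const_nhds (x := θstar).add (hsqrt_inv.smul hH)
    rw [zero_smul, add_zero] at this
    exact this.congr fun k => (hθ k).symm
  have hθstar : θstar ∈ N := mem_of_mem_nhds hN
  have hf_nonneg : ∀ t, 0 < t → 0 ≤ f t := fun t ht =>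
    nonneg_of_convexOn hf_conv hf_diff hf_one hf_deriv hf_deriv2 ht
  -- moments of the score at `θ*`
  have hgrad : (fun x => gradRatio φ x θstar) = fun x => gradLogRatio φ x θstar :=
    funext fun x => gradRatio_eq_gradLogRatio hφ_diff hstar x
  have hL2 : ∀ i, MemLp (fun x => gradLogRatio φ x θstar i) 2 P := hMU_int θstar hθstar
  have hL2' : ∀ i, MemLp (fun x => gradRatio φ x θstar i) 2 P := fun i => by
    simpa only [gradRatio_eq_gradLogRatio hφ_diff hstar] using hL2 i
  set C := covMat P fun x => gradRatio φ x θstar with hC_def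
  set M := matM P φ θstar with hM_def
  set U := matU P φ ρ θstar
  have hMdet : M.det ≠ 0 := hM_det θstar hθstar
  have hUM : U = (1 + ρ)⁻¹ • M := matU_eq_smul_matM hstar
  have hC : C.PosSemidef := posSemidef_covMat hL2'
  have hMC : M = C + Matrix.vecMulVec (fun i => ∫ x, gradLogRatio φ x θstar i ∂P)
      (fun i => ∫ x, gradLogRatio φ x θstar i ∂P) := by
    rw [hC_def, hgrad]
    exact matM_eq_covMat_add hL2
  have hM_eq : M = Matrix.of fun i j => ∫ x, gradRatio φ x θstar i * gradRatio φ x θstar j ∂P := by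
    simp only [gradRatio_eq_gradLogRatio hφ_diff hstar]
    rfl
  -- the limit law of the estimator
  set W : ∀ k, Samples X (mn k) (md k) → Vec (q + 1) := fun k ω =>
    WithLp.toLp 2 (√(m k) • (matU P φ ρ (θ k)).mulVec (θhat k ω - θ k).ofLp)
  set Y : ∀ k, Samples X (mn k) (md k) → Vec (q + 1) := fun k ω =>
    √(m k) • (θhat k ω - θstar) with hY_def
  set ν := multivariateGaussian (0 : Vec (q + 1)) (((1 + ρ) ^ 2)⁻¹ • C)
  have hθY : ∀ k ω, θhat k ω = θstar + (√(m k))⁻¹ • Y k ω := fun k ω => by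
    rw [hY_def, smul_smul, inv_mul_cancel₀ (hsqrt k).ne', one_smul, add_sub_cancel]
  have hWY : ∀ k ω, W k ω = WithLp.toLp 2 ((matU P φ ρ (θ k)).mulVec (Y k ω - H k).ofLp) := by
    intro k ω
    have h1 : Y k ω - H k = √(m k) • (θhat k ω - θ k) := by
      rw [hθ k, hY_def, ← sub_sub, smul_sub _ _ ((√(effSize (mn k) (md k)))⁻¹ • H k), smul_smul,
        mul_inv_cancel₀ (hsqrt k).ne', one_smul]
    rw [h1, WithLp.ofLp_smul, Matrix.mulVec_smul]
  have hU_lim : Tendsto (fun k => matU P φ ρ (θ k)) atTop (𝓝 U) :=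
    (hU_cont.continuousAt hN).tendsto.comp hθ_lim
  have hW_bdd : BoundedInProb μ fun k ω => ‖W k ω‖ := boundedInProb_norm hθhat_clt
  set T : Vec (q + 1) → Vec (q + 1) := fun w => WithLp.toLp 2 (U⁻¹.mulVec w.ofLp) + h
  have hT_eq : ∀ w, T w = Matrix.toEuclideanCLM (𝕜 := ℝ) U⁻¹ w + h := fun w => rfl
  have hT_cont : Continuous T :=
    (Matrix.toEuclideanCLM (𝕜 := ℝ) U⁻¹).continuous.add continuous_const
  have hYT : TendstoInProb μ (fun k ω => ‖Y k ω - T (W k ω)‖) 0 :=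
    tendstoInProb_affine hU_lim (hU_det θstar hθstar) hH hW_bdd hWY
  have hT_bdd : BoundedInProb μ fun k ω => ‖T (W k ω)‖ := by
    refine hW_bdd.of_abs_le (norm_nonneg (Matrix.toEuclideanCLM (𝕜 := ℝ) U⁻¹)) (norm_nonneg h)
      (Eventually.of_forall fun k ω => ?_)
    rw [abs_norm, abs_norm, hT_eq]
    exact (norm_add_le _ _).trans (add_le_add_left (ContinuousLinearMap.le_opNorm _ _) _)
  have hY_bdd : BoundedInProb μ fun k ω => ‖Y k ω‖ :=
    TendstoInProb.add_boundedInProb hT_bdd (hYT.of_abs_le (Eventually.of_forall fun k =>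
      ae_of_all _ fun ω => by
        rw [sub_zero, abs_norm]
        exact abs_norm_sub_norm_le _ _))
  -- both samples behave asymptotically like samples from `P`
  have hsnd : ∀ k, MeasurePreserving Prod.snd (μ k) (Measure.pi fun _ : Fin (md k) => P) :=
    fun k => measurePreserving_snd
  have hSn : AsymptoticSample P μ (fun k (ω : Samples X (mn k) (md k)) => ω.1) :=
    asymptoticSample_altLaw hφ_meas hφ_diff hstar hmn_pos hmn hm hθ_lim hs_meas hs_small he hPn
  have hSd : AsymptoticSample P μ (fun k (ω : Samples X (mn k) (md k)) => ω.2) :=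
    asymptoticSample_of_tendsto (Q := fun _ => P) (fun k => Measure.AbsolutelyContinuous.rfl) hmd
      hmd_pos (fun g hg _ => tendsto_const_nhds) hsnd
  have hv_meas : ∀ i, Measurable fun x => gradRatio φ x θstar i := fun i =>
    (measurable_pi_apply i).comp ((WithLp.measurable_ofLp 2 (Fin (q + 1) → ℝ)).comp
      (measurable_gradRatio hφ_meas hφ_diff θstar))
  set κ := deriv (deriv f) 1 / (2 * (1 + ρ)) with hκ_def
  have hn := tendstoInProb_sampleMean_fD hSn hφ_meas hφ_diff hstar hf_conv hf_diff hf_one hf_deriv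
    hf_deriv2 hρ hL2' hG_meas hG_int hG_dom hG_lln (fun i j => by
      have := hM_lln i j
      rw [hM_eq] at this
      exact this) hm0 hm hY_bdd
  have hd := tendstoInProb_sampleMean_fD hSd hφ_meas hφ_diff hstar hf_conv hf_diff hf_one hf_deriv
    hf_deriv2 hρ hL2' hG_meas hG_int hG_dom
    (tendstoInProb_sampleMean hmd hmd_pos hsnd hG_meas hG_int)
    (fun i j => tendstoInProb_sampleMean hmd hmd_pos hsnd ((hv_meas i).mul (hv_meas j))
      ((hL2' i).integrable_mul (hL2' j))) hm0 hm hY_bdd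
  rw [← hM_eq] at hn hd
  simp only [← hθY, ← hκ_def] at hn hd
  -- quadratic approximation of the test statistics
  set c := deriv (deriv f) 1 with hc_def
  set A : ∀ k, Samples X (mn k) (md k) → ℝ := fun k ω =>
    sampleMean (fun x => fD f ρ (ratio φ x (θhat k ω))) ω.2
      + ρ * sampleMean (fun x => fD f ρ (ratio φ x (θhat k ω))) ω.1 with hA_def
  have hρ1 : 0 < 1 + ρ := by positivity
  have hA_lim : TendstoInProb μ
      (fun k ω => 2 * m k / c * A k ω - quadForm M (Y k ω)) 0 := by
    have h1 := (hd.add (hn.const_mul ρ)).const_mul (2 / c)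
    simp only [mul_zero, add_zero] at h1
    refine h1.congr fun k => ae_of_all _ fun ω => ?_
    simp only [hA_def, hκ_def]
    have := hf_deriv2.ne'
    field_simp
    ring
  have hquad_bdd : ∀ B : Matrix (Fin (q + 1)) (Fin (q + 1)) ℝ,
      BoundedInProb μ fun k ω => quadForm B (Y k ω) := fun B => by
    refine hY_bdd.mul_self.of_abs_le (norm_nonneg (Matrix.toEuclideanCLM (𝕜 := ℝ) B)) le_rfl
      (Eventually.of_forall fun k ω => ?_)
    rw [add_zero, abs_of_nonneg (sq_nonneg ‖Y k ω‖)]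
    exact abs_quadForm_le B _
  have hA_bdd : BoundedInProb μ fun k ω => 2 * m k / c * A k ω :=
    TendstoInProb.add_boundedInProb (hquad_bdd M) hA_lim
  have hD_lim : TendstoInProb μ
      (fun k ω => 2 * m k / c * divEst f φ ω (θhat k ω) - quadForm M (Y k ω)) 0 := by
    have h1 : Tendsto (fun k => |sampleRatio (mn k) (md k) - ρ| / sampleRatio (mn k) (md k)
        + |sampleRatio (mn k) (md k) - ρ| / ρ) atTop (𝓝 0) := by
      have h2 : Tendsto (fun k => |sampleRatio (mn k) (md k) - ρ|) atTop (𝓝 0) := by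
        simpa using (hratio.sub_const ρ).abs
      simpa using (h2.div hratio hρ.ne').add (h2.div_const ρ)
    have h2 : TendstoInProb μ
        (fun k ω => 2 * m k / c * divEst f φ ω (θhat k ω) - 2 * m k / c * A k ω) 0 := by
      refine ((tendstoInProb_of_tendsto h1).mul_bounded hA_bdd).of_abs_le
        (Eventually.of_forall fun k => ae_of_all _ fun ω => ?_)
      have h3 := abs_divEst_sub_le hf_nonneg hρ (hmn_pos k) (hmd_pos k) ω (φ := φ) (θhat k ω)
      have h4 : 0 ≤ 2 * m k / c := div_nonneg (mul_nonneg two_pos.le (hm0 k).le) hf_deriv2.le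
      rw [sub_zero, ← mul_sub, abs_mul, abs_of_nonneg h4]
      refine (mul_le_mul_of_nonneg_left h3 h4).trans (le_trans (le_of_eq ?_) (le_abs_self _))
      simp only [hA_def]
      ring
    simpa using h2.add hA_lim
  have hS_lim : TendstoInProb μ
      (fun k ω => elStat (m k) θstar (θhat k ω) (Vhat k ω) - quadForm C (Y k ω)) 0 := by
    have hb : BoundedInProb μ fun k ω => ‖betaPart (Y k ω)‖ :=
      hY_bdd.of_abs_le (norm_nonneg (betaPartL q)) le_rfl (Eventually.of_forall fun k ω => by
        rw [abs_norm, abs_norm, add_zero]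
        exact (betaPartL q).le_opNorm _)
    refine (tendstoInProb_sum_quadratic hVhat hb).congr fun k => ae_of_all _ fun ω => ?_
    rw [elStat_eq_quadForm (hm0 k).le, quadForm_covMat_betaPart hφ_diff hstar]
  -- the limits have no atoms
  set χ := chiSquareQuantile q (1 - a)
  have hCM : ∀ y, quadForm C y ≤ quadForm M y := fun y => by
    rw [hMC, quadForm_add_vecMulVec]
    exact le_add_of_nonneg_right (sq_nonneg _)
  have hlim : ∀ (B : Matrix (Fin (q + 1)) (Fin (q + 1)) ℝ),
      TendstoInDistribution (fun k ω => quadForm B (T (W k ω))) atTop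
        (fun w => quadForm B (T w)) μ ν := fun B =>
    hθhat_clt.continuous_comp (g := quadForm B ∘ T) ((continuous_quadForm B).comp hT_cont)
  have hsub : ∀ (B : Matrix (Fin (q + 1)) (Fin (q + 1)) ℝ),
      TendstoInProb μ (fun k ω => quadForm B (Y k ω) - quadForm B (T (W k ω))) 0 := fun B =>
    tendstoInProb_quadForm_sub B hY_bdd hT_bdd hYT
  have hatom : ∀ (B : Matrix (Fin (q + 1)) (Fin (q + 1)) ℝ), (∀ y, quadForm C y ≤ quadForm B y) →
      ν {w | quadForm B (T w) = χ} = 0 := fun B hB =>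
    multivariateGaussian_quadForm_affine_eq_zero hq hC hMC hMdet (inv_ne_zero hρ1.ne')
      (by positivity) hUM hB h χ
  refine ⟨ν.real {w | χ ≤ quadForm M (T w)}, ν.real {w | χ ≤ quadForm C (T w)}, ?_, ?_, ?_⟩
  · refine tendsto_measureReal_of_tendstoInDistribution (hlim M)
      (R := fun k ω => 2 * m k / c * divEst f φ ω (θhat k ω))
      (by simpa using hD_lim.add (hsub M))
      (hatom M hCM) ?_ ?_
    · refine Eventually.of_forall fun k ω (hω : χ < _) => ?_
      rw [rejectDiv_eq hc_def.symm hf_deriv2 (hmn_pos k) (hmd_pos k)]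
      exact hω.le
    · refine Eventually.of_forall fun k => ?_
      rw [rejectDiv_eq hc_def.symm hf_deriv2 (hmn_pos k) (hmd_pos k)]
  · refine tendsto_measureReal_of_tendstoInDistribution (hlim C)
      (R := fun k ω => elStat (m k) θstar (θhat k ω) (Vhat k ω))
      (by simpa using hS_lim.add (hsub C))
      (hatom C fun _ => le_rfl) ?_ ?_
    · exact Eventually.of_forall fun k ω hω => hω
    · exact Eventually.of_forall fun k ω (hω : χ < _) => hω.le
  · exact measureReal_mono fun w (hw : χ ≤ _) => hw.trans (hCM _)
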